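/- **Setting.** Let $d>0$ be a square-free integer such that $k_d=\mathbb{Q}(\sqrt{-d})\subset\mathbb{C}$ has class number one, and let $\mathcal{O}_d$ be its ring of integers. A *discriminant* is an element $D\in\mathcal{O}_d$ that is congruent to a square modulo $4$ and is not a square. For a solution $(t,u)\in\mathcal{O}_d^2$ of $t^2-Du^2=4$ put $\epsilon_{t,u}=\tfrac12(t+u\sqrt D)$, with $\arg\sqrt D\in[0,\pi)$; the solution is *fundamental* if $|\epsilon_{t,u}|$ is the smallest value larger than $1$ attained by solutions. Let $D$ be a discriminant with $|D|>51$, let $(t_0,u_0)$ be a fundamental solution, $\epsilon_D=\epsilon_{t_0,u_0}$, and define $t_n,u_n\in\mathcal{O}_d$ by $\epsilon_D^{n+1}=\tfrac12(t_n+u_n\sqrt D)$. Let $$m=\min\{n\ge 0:\ |t_n|<\tfrac49|u_n|^2\},\qquad t=t_m,\quad u=u_m.$$ Let $\tau\in\mathcal{O}_d/u\mathcal{O}_d$ be the class of $\tfrac12(t-\beta u)$, where $\beta\in\mathcal{O}_d$ is any element with $\beta^2\equiv D \pmod 4$ (this class lies in $\mathcal{O}_d/u\mathcal{O}_d$, does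 not depend on $\beta$, and satisfies $\tau^2=1$). Let $\Gamma\subset\mathrm{SL}_2(\mathcal{O}_d)$ be the preimage of $\{\mathrm{Id},\tau\,\mathrm{Id}\}$ under reduction modulo $u\mathcal{O}_d$, and let $M=\Gamma\backslash\mathbb{H}^3$. For a hyperbolic $3$-manifold $M$, let $\mathrm{sys}(M)$ be the shortest length of a closed geodesic and $\mathrm{Kiss}(M)$ the number of free homotopy classes of oriented closed geodesics of length $\mathrm{sys}(M)$. Let $h(D)$ be the number of $\mathrm{SL}_2(\mathcal{O}_d)$-equivalence classes of binary quadratic forms $Q=ax^2+bxy+cy^2$ over $\mathcal{O}_d$ that are primitive, i.e. $(a,b,c)=\mathcal{O}_d$, and have discriminant $b^2-4ac=D$. For such a form $Q$ put $$\epsilon_Q=\begin{pmatrix}\frac{t_0-bu_0}{2}&-cu_0\\ au_0&\frac{t_0+bu_0}{2}\end{pmatrix}\in\mathrm{SL}_2(\mathcal{O}_d).$$ **Proposition.** The minimum defining $m$ exists, $\Gamma$ is discrete and torsion-free (so $M$ is a hyperbolic $3$-manifold), and $$\mathrm{Kiss}(M)\ \ge\ h(D).$$ Moreover: 1. for every primitive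 form $Q$ of discriminant $D$, the matrix $\epsilon_Q$ is an automorph of $Q$, is loxodromic, and is primitive in the sense that $\epsilon_Q=A^n$ with $A\in\mathrm{SL}_2(\mathcal{O}_d)$ and $n\ge1$ forces $n=1$; its power $\epsilon_Q^{m+1}$ lies in $\Gamma$ and determines a closed geodesic of $M$ of length $\mathrm{sys}(M)$; 2. if $Q,Q'$ are inequivalent primitive forms of discriminant $D$, then $\epsilon_Q$ and $\epsilon_{Q'}$ are not conjugate in $\mathrm{SL}_2(\mathcal{O}_d)$, and neither are $\epsilon_Q^{m+1}$ and $\epsilon_{Q'}^{m+1}$; in particular these powers are not conjugate in $\Gamma$. -/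

import Mathlib

open scoped NumberField MatrixGroups ComplexConjugate

noncomputable section

namespace HypKiss

/-! ## Hyperbolic 3-space and its quotients -/

/-- Upper half-space `{(z, t) : z ∈ ℂ, t > 0}`. -/
def H3 : Type := {p : ℂ × ℝ // 0 < p.2}

namespace H3

instance : TopologicalSpace H3 := inferInstanceAs (TopologicalSpace {p : ℂ × ℝ // 0 < p.2})

/-- The horizontal coordinate. -/
def z (p : H3) : ℂ := p.1.1

/-- The height. -/
def t (p : H3) : ℝ := p.1.2

theorem t_pos (p : H3) : 0 < p.t := p.2

/-- The point with given coordinates. -/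
def mk (z : ℂ) (t : ℝ) (ht : 0 < t) : H3 := ⟨(z, t), ht⟩

@[ext] theorem ext {p q : H3} (h1 : p.z = q.z) (h2 : p.t = q.t) : p = q :=
  Subtype.ext (Prod.ext h1 h2)

/-- The hyperbolic distance, i.e. the Riemannian distance of the metric
`(dx² + dy² + dt²) / t²`: it satisfies `sinh (d(p,q) / 2) = |p - q| / (2 √(t s))` where `|p - q|`
is the Euclidean distance and `t`, `s` are the heights. -/
def hdist (p q : H3) : ℝ :=
  2 * Real.arsinh (√(‖p.z - q.z‖ ^ 2 + (p.t - q.t) ^ 2) / (2 * √(p.t * q.t)))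

/-- The denominator `|cz + d|² + |c|² t²` of the Poincaré extension. -/
def den (g : SL(2, ℂ)) (p : H3) : ℝ := ‖g 1 0 * p.z + g 1 1‖ ^ 2 + ‖g 1 0‖ ^ 2 * p.t ^ 2

theorem den_pos (g : SL(2, ℂ)) (p : H3) : 0 < den g p := by
  have hd := g.det_coe
  rw [Matrix.det_fin_two] at hd
  have ht := p.t_pos
  unfold den
  by_cases hc : g 1 0 = 0
  · have h1 : g 1 1 ≠ 0 := by
      intro h1
      simp [hc, h1] at hd
    have : 0 < ‖g 1 1‖ := norm_pos_iff.mpr h1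
    simp only [hc, zero_mul, zero_add, norm_zero]
    positivity
  · have : 0 < ‖g 1 0‖ := norm_pos_iff.mpr hc
    positivity

/-- The Poincaré extension to upper half-space of the linear fractional action on `ℂ`. -/
instance : SMul SL(2, ℂ) H3 where
  smul g p := mk
    (((g 0 0 * p.z + g 0 1) * conj (g 1 0 * p.z + g 1 1) + g 0 0 * conj (g 1 0) * (p.t : ℂ) ^ 2)
      / (den g p : ℂ))
    (p.t / den g p) (div_pos p.t_pos (den_pos g p))

theorem smul_z (g : SL(2, ℂ)) (p : H3) : (g • p).z =
    ((g 0 0 * p.z + g 0 1) * conj (g 1 0 * p.z + g 1 1) + g 0 0 * conj (g 1 0) * (p.t : ℂ) ^ 2)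
      / (den g p : ℂ) := rfl

theorem smul_t (g : SL(2, ℂ)) (p : H3) : (g • p).t = p.t / den g p := rfl

theorem den_coe (g : SL(2, ℂ)) (p : H3) : (den g p : ℂ) =
    (g 1 0 * p.z + g 1 1) * conj (g 1 0 * p.z + g 1 1)
      + g 1 0 * conj (g 1 0) * (p.t : ℂ) ^ 2 := by
  simp only [den, Complex.mul_conj, Complex.normSq_eq_norm_sq]
  push_cast
  ring

theorem den_coe_ne (g : SL(2, ℂ)) (p : H3) : (den g p : ℂ) ≠ 0 :=
  Complex.ofReal_ne_zero.mpr (den_pos g p).ne'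

/-- `|z'|² + t'² = (|az + b|² + |a|² t²) / den` for `(z', t') = g • (z, t)`. -/
theorem smul_normSq (g : SL(2, ℂ)) (p : H3) :
    ((g • p).z * conj (g • p).z + ((g • p).t : ℂ) ^ 2) * (den g p : ℂ) =
      (g 0 0 * p.z + g 0 1) * conj (g 0 0 * p.z + g 0 1)
        + g 0 0 * conj (g 0 0) * (p.t : ℂ) ^ 2 := by
  have hd : g 0 0 * g 1 1 - g 0 1 * g 1 0 = 1 := by
    have := g.det_coe
    rwa [Matrix.det_fin_two] at this
  have hd' : conj (g 0 0) * conj (g 1 1) - conj (g 0 1) * conj (g 1 0) = 1 := by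
    simpa using congrArg conj hd
  have hD := den_coe_ne g p
  have key : ∀ W W' T D N : ℂ, D ≠ 0 → W * W' + T ^ 2 = N * D →
      (W / D * (W' / D) + (T / D) ^ 2) * D = N := by
    intro W W' T D N hD h
    field_simp
    rw [h, mul_comm]
  rw [smul_z, smul_t, Complex.ofReal_div, map_div₀, Complex.conj_ofReal]
  refine key _ _ _ _ _ hD ?_
  rw [den_coe]
  simp only [map_add, map_mul, map_pow, Complex.conj_conj, Complex.conj_ofReal]
  linear_combination (-(p.t : ℂ) ^ 2 * (conj (g 0 0) * conj (g 1 1) - conj (g 0 1) * conj (g 1 0)))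
    * hd - (p.t : ℂ) ^ 2 * hd'

theorem mul_entry (g h : SL(2, ℂ)) (i j : Fin 2) :
    (g * h) i j = g i 0 * h 0 j + g i 1 * h 1 j := by
  simp [Matrix.mul_apply, Fin.sum_univ_two]

theorem smul_z_mul_den (g : SL(2, ℂ)) (p : H3) : (g • p).z * (den g p : ℂ) =
    (g 0 0 * p.z + g 0 1) * conj (g 1 0 * p.z + g 1 1)
      + g 0 0 * conj (g 1 0) * (p.t : ℂ) ^ 2 := by
  rw [smul_z, div_mul_cancel₀ _ (den_coe_ne g p)]

theorem smul_z_conj_mul_den (g : SL(2, ℂ)) (p : H3) : conj (g • p).z * (den g p : ℂ) =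
    conj (g 0 0 * p.z + g 0 1) * (g 1 0 * p.z + g 1 1)
      + conj (g 0 0) * g 1 0 * (p.t : ℂ) ^ 2 := by
  have := congrArg conj (smul_z_mul_den g p)
  simpa only [map_add, map_mul, map_pow, Complex.conj_conj, Complex.conj_ofReal] using this

theorem den_mul (g h : SL(2, ℂ)) (p : H3) : den (g * h) p = den g (h • p) * den h p := by
  apply Complex.ofReal_injective
  have e1 := smul_normSq h p
  have e2 := smul_z_mul_den h p
  have e3 := smul_z_conj_mul_den h p
  have e4 := den_coe h p
  rw [Complex.ofReal_mul, den_coe, den_coe g]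
  simp only [mul_entry, map_add, map_mul] at *
  linear_combination (-g 1 0 * conj (g 1 0)) * e1 - g 1 0 * conj (g 1 1) * e2
    - g 1 1 * conj (g 1 0) * e3 - g 1 1 * conj (g 1 1) * e4

instance : MulAction SL(2, ℂ) H3 where
  one_smul p := by
    have hden : den 1 p = 1 := by simp [den]
    ext
    · simp [smul_z, hden]
    · simp [smul_t, hden]
  mul_smul g h p := by
    have hm := den_mul g h p
    ext
    · have e1 := smul_normSq h p
      have e2 := smul_z_mul_den h p
      have e3 := smul_z_conj_mul_den h p
      have e4 := den_coe h p
      have e5 := smul_z_mul_den (g * h) p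
      have e6 := smul_z_mul_den g (h • p)
      have h1 := den_coe_ne h p
      have h2 := den_coe_ne g (h • p)
      rw [hm, Complex.ofReal_mul] at e5
      apply mul_right_cancel₀ (mul_ne_zero h2 h1)
      rw [e5, ← mul_assoc, e6]
      simp only [mul_entry, map_add, map_mul] at *
      linear_combination (-g 0 0 * conj (g 1 0)) * e1 - g 0 0 * conj (g 1 1) * e2
        - g 0 1 * conj (g 1 0) * e3 - g 0 1 * conj (g 1 1) * e4
    · simp only [smul_t, hm]
      rw [div_div, mul_comm]

/-- A complete unit-speed geodesic of hyperbolic 3-space. -/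
def IsGeodesicLine (c : ℝ → H3) : Prop := ∀ s s' : ℝ, hdist (c s) (c s') = |s - s'|

end H3

/-- The quotient `Γ \ ℍ³`, with the quotient topology. -/
abbrev Quot3 (Γ : Subgroup SL(2, ℂ)) : Type := MulAction.orbitRel.Quotient Γ H3

/-- The projection `ℍ³ → Γ \ ℍ³`. -/
def proj (Γ : Subgroup SL(2, ℂ)) (p : H3) : Quot3 Γ := Quotient.mk _ p

/-- `Γ` is a discrete subgroup of `SL(2, ℂ)` without nontrivial elements of finite order. As `-1`
has order two, such a `Γ` maps isomorphically onto a discrete torsion-free subgroup of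
`PSL(2, ℂ)`, and `Γ \ ℍ³` is a hyperbolic 3-manifold. -/
def IsDiscreteTorsionFree (Γ : Subgroup SL(2, ℂ)) : Prop :=
  DiscreteTopology {A : Matrix (Fin 2) (Fin 2) ℂ // ∃ g ∈ Γ, (g : Matrix (Fin 2) (Fin 2) ℂ) = A} ∧
    ∀ g ∈ Γ, g ≠ 1 → ∀ n : ℕ, 0 < n → g ^ n ≠ 1

/-- Loops in a space, parametrized by the circle `ℝ / ℤ`. -/
abbrev Loop (X : Type) [TopologicalSpace X] : Type := C(UnitAddCircle, X)

/-- Free homotopy classes of (oriented) loops. -/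
def FreeHomotopyClass (X : Type) [TopologicalSpace X] : Type :=
  Quotient (⟨ContinuousMap.Homotopic, ContinuousMap.Homotopic.equivalence⟩ : Setoid (Loop X))

/-- The free homotopy class of a loop. -/
def freeClass {X : Type} [TopologicalSpace X] (f : Loop X) : FreeHomotopyClass X := Quotient.mk _ f

/-- `f` is a closed geodesic of length `L` of `Γ \ ℍ³`, parametrized proportionally to arc length.
The geodesics of `Γ \ ℍ³` are the projections of the geodesics of `ℍ³`. -/
def IsClosedGeodesic (Γ : Subgroup SL(2, ℂ)) (L : ℝ) (f : Loop (Quot3 Γ)) : Prop :=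
  0 < L ∧ ∃ c : ℝ → H3, H3.IsGeodesicLine c ∧
    ∀ s : ℝ, f (s : UnitAddCircle) = proj Γ (c (L * s))

/-- `f` is the closed geodesic of length `L` of `Γ \ ℍ³` determined by the element `g`: it lifts to
a geodesic of `ℍ³` along which `g` is a translation by `L`. -/
def IsClosedGeodesicOf (Γ : Subgroup SL(2, ℂ)) (g : SL(2, ℂ)) (L : ℝ) (f : Loop (Quot3 Γ)) :
    Prop :=
  0 < L ∧ ∃ c : ℝ → H3, H3.IsGeodesicLine c ∧ (∀ s : ℝ, g • c s = c (s + L)) ∧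
    ∀ s : ℝ, f (s : UnitAddCircle) = proj Γ (c (L * s))

/-- The systole of `Γ \ ℍ³`. -/
def systole (Γ : Subgroup SL(2, ℂ)) : ℝ :=
  sInf {L : ℝ | ∃ f : Loop (Quot3 Γ), IsClosedGeodesic Γ L f}

/-- The kissing number of `Γ \ ℍ³`: the number of free homotopy classes of oriented closed
geodesics whose length is the systole. -/
def kiss (Γ : Subgroup SL(2, ℂ)) : ℕ∞ :=
  Set.encard {C : FreeHomotopyClass (Quot3 Γ) |
    ∃ f : Loop (Quot3 Γ), IsClosedGeodesic Γ (systole Γ) f ∧ freeClass f = C}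

/-- Neither elliptic nor parabolic nor `± 1`: the trace is not a real number in `[-2, 2]`. -/
def IsLoxodromic (g : SL(2, ℂ)) : Prop :=
  ¬ ∃ x : ℝ, |x| ≤ 2 ∧ (g : Matrix (Fin 2) (Fin 2) ℂ).trace = (x : ℂ)

/-! ## Imaginary quadratic fields, the Pell equation -/

/-- The field `ℚ(√-d)`, as a subfield of `ℂ`. -/
abbrev kd (d : ℕ) : IntermediateField ℚ ℂ :=
  IntermediateField.adjoin ℚ {((√(d : ℝ) : ℝ) : ℂ) * Complex.I}

instance (d : ℕ) : NumberField (kd d) where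
  to_finiteDimensional := by
    apply IntermediateField.adjoin.finiteDimensional
    refine ⟨Polynomial.X ^ 2 + Polynomial.C (d : ℚ),
      Polynomial.monic_X_pow_add_C _ two_ne_zero, ?_⟩
    have h : ((√(d : ℝ) : ℝ) : ℂ) ^ 2 = (d : ℂ) := by
      exact_mod_cast congrArg Complex.ofReal (Real.sq_sqrt (Nat.cast_nonneg d))
    simp [mul_pow, h]

/-- The ring of integers of `ℚ(√-d)`. -/
abbrev Od (d : ℕ) : Type := 𝓞 (kd d)

/-- The inclusion of the ring of integers into `ℂ`. -/
def emb (d : ℕ) : Od d →+* ℂ := (algebraMap (kd d) ℂ).comp (algebraMap (Od d) (kd d))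

variable {d : ℕ}

/-- `D` is a discriminant: a square modulo `4`, but not a square. -/
def IsDiscriminant (D : Od d) : Prop := (∃ x : Od d, 4 ∣ D - x ^ 2) ∧ ¬ IsSquare D

/-- The square root of a complex number whose argument lies in `[0, π)`. -/
def sqrtUp (w : ℂ) : ℂ := if (w ^ (1 / 2 : ℂ)).im < 0 then -w ^ (1 / 2 : ℂ) else w ^ (1 / 2 : ℂ)

theorem sqrtUp_sq (w : ℂ) : sqrtUp w ^ 2 = w := by
  unfold sqrtUp
  split_ifs <;> simp

/-- `ε_{t,u} = (t + u √D) / 2`. -/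
def eps (D t u : Od d) : ℂ := (emb d t + emb d u * sqrtUp (emb d D)) / 2

/-- The solutions of the equation `t² - D u² = 4`. -/
def IsPell (D t u : Od d) : Prop := t ^ 2 - D * u ^ 2 = 4

/-- `(t₀, u₀)` is a fundamental solution: `|ε_{t₀,u₀}|` is the smallest possible value larger than
one. -/
def IsFundamentalSolution (D t₀ u₀ : Od d) : Prop :=
  IsPell D t₀ u₀ ∧ 1 < ‖eps D t₀ u₀‖ ∧
    ∀ t u : Od d, IsPell D t u → 1 < ‖eps D t u‖ → ‖eps D t₀ u₀‖ ≤ ‖eps D t u‖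

theorem emb_inj : Function.Injective (emb d) :=
  (algebraMap (kd d) ℂ).injective.comp (FaithfulSMul.algebraMap_injective (Od d) (kd d))

/-- If `b² ≡ D` modulo `4` and `t² - D u² = 4`, then `t - b u` is divisible by `2`. -/
theorem exists_half {D t u b : Od d} (hb : 4 ∣ D - b ^ 2) (h : IsPell D t u) :
    ∃ x : Od d, 2 * x = t - b * u := by
  obtain ⟨ξ, hξ⟩ := hb
  have h' : t ^ 2 - D * u ^ 2 = 4 := h
  set y : kd d := algebraMap (Od d) (kd d) (t - b * u) / 2 with hy
  have hint : IsIntegral (Od d) y := by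
    refine ⟨Polynomial.X ^ 2 - Polynomial.C t * Polynomial.X + Polynomial.C (1 + ξ * u ^ 2),
      ?_, ?_⟩
    · monicity!
    · have e : algebraMap (Od d) (kd d) ((t - b * u) ^ 2 - 2 * t * (t - b * u)
          + 4 * (1 + ξ * u ^ 2)) = 0 := by
        rw [show (t - b * u) ^ 2 - 2 * t * (t - b * u) + 4 * (1 + ξ * u ^ 2) = 0 by
          linear_combination (-1 : Od d) * h' - u ^ 2 * hξ, map_zero]
      simp only [map_add, map_sub, map_mul, map_pow, map_ofNat, map_one] at e hy
      simp only [Polynomial.eval₂_add, Polynomial.eval₂_sub, Polynomial.eval₂_mul,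
        Polynomial.eval₂_pow, Polynomial.eval₂_X, Polynomial.eval₂_C, hy, map_add, map_mul,
        map_pow, map_one,
        Polynomial.eval₂_one]
      linear_combination (1 / 4 : kd d) * e
  obtain ⟨x, hx⟩ := IsIntegrallyClosed.isIntegral_iff.mp hint
  refine ⟨x, FaithfulSMul.algebraMap_injective (Od d) (kd d) ?_⟩
  rw [map_mul, hx, hy, map_ofNat]
  ring

/-- The element `(t - b u) / 2`. -/
def half {D t u b : Od d} (hb : 4 ∣ D - b ^ 2) (h : IsPell D t u) : Od d :=
  (exists_half hb h).choose

theorem two_mul_half {D t u b : Od d} (hb : 4 ∣ D - b ^ 2) (h : IsPell D t u) :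
    2 * half hb h = t - b * u := (exists_half hb h).choose_spec

theorem half_mul {D t u b ξ : Od d} (hb : 4 ∣ D - b ^ 2) (h : IsPell D t u)
    (hξ : D - b ^ 2 = 4 * ξ) : half hb h * (half hb h + b * u) = 1 + ξ * u ^ 2 := by
  have h2 := two_mul_half hb h
  have h' : t ^ 2 - D * u ^ 2 = 4 := h
  have h4 : (4 : Od d) ≠ 0 := OfNat.ofNat_ne_zero 4
  apply mul_left_cancel₀ h4
  linear_combination (2 * half hb h + 2 * b * u + t - b * u) * h2 + h' + u ^ 2 * hξ

/-- The sequences `t₀, t₁, …` and `u₀, u₁, …` with `(t_n + u_n √D) / 2 = ε_{t₀,u₀} ^ (n + 1)`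
(see `eps_pow`), given by their common linear recurrence `x_{n+1} = t₀ x_n - x_{n-1}`
with `t_{-1} = 2`, `u_{-1} = 0`. Both components are computed together: the value at `n` is
`(x_n, x_{n-1})`. -/
def lucas (t₀ x₀ x₁ : Od d) : ℕ → Od d × Od d
  | 0 => (x₀, x₁)
  | n + 1 => (t₀ * (lucas t₀ x₀ x₁ n).1 - (lucas t₀ x₀ x₁ n).2, (lucas t₀ x₀ x₁ n).1)

/-- `t_n`. -/
def pellT (t₀ : Od d) (n : ℕ) : Od d := (lucas t₀ t₀ 2 n).1

/-- `u_n`. -/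
def pellU (t₀ u₀ : Od d) (n : ℕ) : Od d := (lucas t₀ u₀ 0 n).1

theorem lucas_pell {D t₀ u₀ : Od d} (h : IsPell D t₀ u₀) (n : ℕ) :
    eps D (lucas t₀ t₀ 2 n).1 (lucas t₀ u₀ 0 n).1 = eps D t₀ u₀ ^ (n + 1) ∧
    eps D (lucas t₀ t₀ 2 n).2 (lucas t₀ u₀ 0 n).2 = eps D t₀ u₀ ^ n ∧
    IsPell D (lucas t₀ t₀ 2 n).1 (lucas t₀ u₀ 0 n).1 ∧
    IsPell D (lucas t₀ t₀ 2 n).2 (lucas t₀ u₀ 0 n).2 ∧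
    (lucas t₀ t₀ 2 n).1 * (lucas t₀ t₀ 2 n).2
      - D * (lucas t₀ u₀ 0 n).1 * (lucas t₀ u₀ 0 n).2 = 2 * t₀ := by
  have h' : t₀ ^ 2 - D * u₀ ^ 2 = 4 := h
  have hC : emb d t₀ ^ 2 - emb d D * emb d u₀ ^ 2 = 4 := by
    have := congrArg (emb d) h'
    simpa only [map_sub, map_mul, map_pow, map_ofNat] using this
  have hs := sqrtUp_sq (emb d D)
  have hq : eps D t₀ u₀ ^ 2 = emb d t₀ * eps D t₀ u₀ - 1 := by
    unfold eps
    linear_combination (-1 / 4 : ℂ) * hC + (emb d u₀ ^ 2 / 4) * hs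
  induction n with
  | zero =>
    refine ⟨by simp [lucas], by simp [lucas, eps, map_ofNat (emb d) 2], h, ?_, ?_⟩
    · simp only [lucas, IsPell]; ring
    · simp only [lucas]; ring
  | succ n ih =>
    obtain ⟨h1, h2, h3, h4, h5⟩ := ih
    simp only [lucas]
    refine ⟨?_, h1, ?_, h3, ?_⟩
    · calc eps D (t₀ * (lucas t₀ t₀ 2 n).1 - (lucas t₀ t₀ 2 n).2)
            (t₀ * (lucas t₀ u₀ 0 n).1 - (lucas t₀ u₀ 0 n).2)
          = emb d t₀ * eps D (lucas t₀ t₀ 2 n).1 (lucas t₀ u₀ 0 n).1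
            - eps D (lucas t₀ t₀ 2 n).2 (lucas t₀ u₀ 0 n).2 := by
              simp only [eps, map_sub, map_mul]; ring
        _ = eps D t₀ u₀ ^ (n + 1 + 1) := by
              rw [h1, h2]
              linear_combination (-eps D t₀ u₀ ^ n) * hq
    · unfold IsPell at *
      linear_combination t₀ ^ 2 * h3 + h4 - 2 * t₀ * h5
    · unfold IsPell at *
      linear_combination t₀ * h3 - h5

theorem eps_pow {D t₀ u₀ : Od d} (h : IsPell D t₀ u₀) (n : ℕ) :
    eps D (pellT t₀ n) (pellU t₀ u₀ n) = eps D t₀ u₀ ^ (n + 1) := (lucas_pell h n).1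

theorem isPell_seq {D t₀ u₀ : Od d} (h : IsPell D t₀ u₀) (n : ℕ) :
    IsPell D (pellT t₀ n) (pellU t₀ u₀ n) := (lucas_pell h n).2.2.1

/-- `m(ε) = min {n ≥ 0 : |t_n| < (4/9) |u_n|²}`. -/
def pellIndex (t₀ u₀ : Od d) : ℕ :=
  sInf {n : ℕ | ‖emb d (pellT t₀ n)‖ < 4 / 9 * ‖emb d (pellU t₀ u₀ n)‖ ^ 2}

/-! ## The congruence subgroups -/

/-- For a discriminant `D` and a solution `(t, u)` of the Pell equation, the class modulo `u` of
`(t - β u) / 2`, where `β` is any element with `β² ≡ D` modulo `4` (see `tau_eq`). -/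
def tau {D t u : Od d} (hD : IsDiscriminant D) (h : IsPell D t u) : Od d ⧸ Ideal.span {u} :=
  Ideal.Quotient.mk (Ideal.span {u}) (half hD.1.choose_spec h)

/-- `tau` is independent of the choices. -/
theorem tau_eq {D t u β x : Od d} (hD : IsDiscriminant D) (h : IsPell D t u)
    (hβ : 4 ∣ D - β ^ 2) (hx : 2 * x = t - β * u) :
    tau hD h = Ideal.Quotient.mk (Ideal.span {u}) x := by
  obtain ⟨ξ, hξ⟩ := hβ
  obtain ⟨ξ', hξ'⟩ := hD.1.choose_spec
  set β' := hD.1.choose with hβ'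
  have h2 : 2 * half hD.1.choose_spec h = t - β' * u := two_mul_half hD.1.choose_spec h
  set y : kd d := algebraMap (Od d) (kd d) (β - β') / 2 with hy
  have hint : IsIntegral (Od d) y := by
    refine ⟨Polynomial.X ^ 2 - Polynomial.C β * Polynomial.X + Polynomial.C (ξ' - ξ),
      ?_, ?_⟩
    · monicity!
    · have e : algebraMap (Od d) (kd d) ((β - β') ^ 2 - 2 * β * (β - β')
          + 4 * (ξ' - ξ)) = 0 := by
        rw [show (β - β') ^ 2 - 2 * β * (β - β') + 4 * (ξ' - ξ) = 0 by
          linear_combination hξ - hξ', map_zero]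
      simp only [map_add, map_sub, map_mul, map_pow, map_ofNat] at e hy
      simp only [Polynomial.eval₂_add, Polynomial.eval₂_sub, Polynomial.eval₂_mul,
        Polynomial.eval₂_pow, Polynomial.eval₂_X, Polynomial.eval₂_C, hy, map_sub]
      linear_combination (1 / 4 : kd d) * e
  obtain ⟨w, hw⟩ := IsIntegrallyClosed.isIntegral_iff.mp hint
  have hw2 : 2 * w = β - β' := by
    apply FaithfulSMul.algebraMap_injective (Od d) (kd d)
    rw [map_mul, hw, hy, map_ofNat]
    ring
  unfold tau
  rw [Ideal.Quotient.mk_eq_mk_iff_sub_mem, Ideal.mem_span_singleton]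
  refine ⟨w, mul_left_cancel₀ (OfNat.ofNat_ne_zero 2 : (2 : Od d) ≠ 0) ?_⟩
  linear_combination h2 - hx - u * hw2

theorem tau_sq {D t u : Od d} (hD : IsDiscriminant D) (h : IsPell D t u) : tau hD h ^ 2 = 1 := by
  obtain ⟨ξ, hξ⟩ := hD.1.choose_spec
  have := half_mul hD.1.choose_spec h hξ
  unfold tau
  rw [← map_pow, ← map_one (Ideal.Quotient.mk (Ideal.span {u})),
    Ideal.Quotient.mk_eq_mk_iff_sub_mem, Ideal.mem_span_singleton]
  exact ⟨ξ * u - half hD.1.choose_spec h * hD.1.choose, by linear_combination this⟩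

/-- Reduction `SL₂(𝒪_d) → SL₂(𝒪_d / u 𝒪_d)`. -/
def red (u : Od d) : SL(2, Od d) →* SL(2, Od d ⧸ Ideal.span {u}) :=
  Matrix.SpecialLinearGroup.map (Ideal.Quotient.mk (Ideal.span {u}))

/-- The scalar matrix `τ Id` in `SL₂` when `τ² = 1`. -/
def scalarSL {R : Type*} [CommRing R] (τ : R) (hτ : τ ^ 2 = 1) : SL(2, R) :=
  ⟨!![τ, 0; 0, τ], by rw [Matrix.det_fin_two_of, ← hτ]; ring⟩

theorem scalarSL_mul_self {R : Type*} [CommRing R] (τ : R) (hτ : τ ^ 2 = 1) :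
    scalarSL τ hτ * scalarSL τ hτ = 1 := by
  have : τ * τ = 1 := by rw [← hτ, sq]
  apply Subtype.ext
  rw [Matrix.SpecialLinearGroup.coe_mul]
  simp [scalarSL, this, Matrix.one_fin_two]

/-- The preimage of `{Id, τ Id}` under reduction modulo `u`. -/
def tauGroup (u : Od d) (τ : Od d ⧸ Ideal.span {u}) (hτ : τ ^ 2 = 1) : Subgroup SL(2, Od d) where
  carrier := {g | red u g = 1 ∨ red u g = scalarSL τ hτ}
  one_mem' := Or.inl (map_one _)
  mul_mem' := by
    rintro g h (hg | hg) (hh | hh)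
    · left; simp [hg, hh]
    · right; simp [hg, hh]
    · right; simp [hg, hh]
    · left; simp [hg, hh, scalarSL_mul_self]
  inv_mem' := by
    rintro g (hg | hg)
    · left; simp [hg]
    · right
      rw [map_inv, hg]
      exact inv_eq_of_mul_eq_one_left (scalarSL_mul_self τ hτ)

/-- The inclusion `SL₂(𝒪_d) → SL₂(ℂ)`. -/
def embSL (d : ℕ) : SL(2, Od d) →* SL(2, ℂ) := Matrix.SpecialLinearGroup.map (emb d)

/-- The group `Γ` attached to a discriminant `D` and a fundamental solution `(t₀, u₀)`, i.e.
the preimage of `{Id, τ Id}` under reduction modulo `u_m`, where `m = m(ε)` and `τ` is attached to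
`(t_m, u_m)`. -/
def gammaD {D t₀ u₀ : Od d} (hD : IsDiscriminant D) (h : IsFundamentalSolution D t₀ u₀) :
    Subgroup SL(2, Od d) :=
  tauGroup (pellU t₀ u₀ (pellIndex t₀ u₀)) (tau hD (isPell_seq h.1 (pellIndex t₀ u₀)))
    (tau_sq hD (isPell_seq h.1 (pellIndex t₀ u₀)))

/-! ## Binary quadratic forms -/

/-- The binary quadratic form `a x² + b x y + c y²`. -/
@[ext] structure BinForm (R : Type*) where
  a : R
  b : R
  c : R

namespace BinForm

variable {R : Type*} [CommRing R]

/-- The value of the form. -/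
def eval (Q : BinForm R) (x y : R) : R := Q.a * x ^ 2 + Q.b * x * y + Q.c * y ^ 2

/-- The discriminant. -/
def disc (Q : BinForm R) : R := Q.b ^ 2 - 4 * Q.a * Q.c

/-- The coefficients generate the unit ideal. -/
def IsPrimitive (Q : BinForm R) : Prop := Ideal.span {Q.a, Q.b, Q.c} = ⊤

/-- Linear substitution: `Q.subst g` is the form `v ↦ Q (g v)` (see `eval_subst`). -/
def subst (Q : BinForm R) (g : SL(2, R)) : BinForm R where
  a := Q.eval (g 0 0) (g 1 0)
  b := 2 * Q.a * g 0 0 * g 0 1 + Q.b * (g 0 0 * g 1 1 + g 0 1 * g 1 0) + 2 * Q.c * g 1 0 * g 1 1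
  c := Q.eval (g 0 1) (g 1 1)

theorem eval_subst (Q : BinForm R) (g : SL(2, R)) (x y : R) :
    (Q.subst g).eval x y = Q.eval (g 0 0 * x + g 0 1 * y) (g 1 0 * x + g 1 1 * y) := by
  simp only [subst, eval]
  ring

theorem subst_one (Q : BinForm R) : Q.subst 1 = Q := by
  ext <;> simp [subst, eval]

theorem subst_mul (Q : BinForm R) (g h : SL(2, R)) : Q.subst (g * h) = (Q.subst g).subst h := by
  ext <;> simp [subst, eval, Matrix.mul_apply, Fin.sum_univ_two] <;> ring

/-- Equivalence of forms: same orbit under `SL₂(R)`. -/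
def Equivalent (Q Q' : BinForm R) : Prop := ∃ g : SL(2, R), Q.subst g = Q'

theorem equivalent_equivalence : Equivalence (Equivalent (R := R)) where
  refl Q := ⟨1, subst_one Q⟩
  symm := by
    rintro Q Q' ⟨g, rfl⟩
    exact ⟨g⁻¹, by rw [← subst_mul, mul_inv_cancel, subst_one]⟩
  trans := by
    rintro Q Q' Q'' ⟨g, rfl⟩ ⟨h, rfl⟩
    exact ⟨g * h, subst_mul Q g h⟩

/-- Equivalence on the primitive forms of discriminant `D`. -/
def formSetoid (D : R) : Setoid {Q : BinForm R // Q.IsPrimitive ∧ Q.disc = D} :=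
  Setoid.comap Subtype.val ⟨Equivalent, equivalent_equivalence⟩

/-- The class number `h(D)`: the number of classes of primitive forms of discriminant `D`. -/
def formClassNumber (D : R) : ℕ∞ := ENat.card (Quotient (formSetoid D))

theorem four_dvd (Q : BinForm R) : 4 ∣ Q.disc - Q.b ^ 2 :=
  ⟨-(Q.a * Q.c), by simp only [disc]; ring⟩

end BinForm

/-- The matrix `((t - b u) / 2, -c u; a u, (t + b u) / 2)` attached to a form
`a x² + b x y + c y²` and a solution `(t, u)` of `t² - (b² - 4ac) u² = 4`. -/
def automorph (Q : BinForm (Od d)) {t u : Od d} (h : IsPell Q.disc t u) : SL(2, Od d) :=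
  ⟨!![half Q.four_dvd h, -(Q.c * u); Q.a * u, half Q.four_dvd h + Q.b * u], by
    have := half_mul Q.four_dvd h (ξ := -(Q.a * Q.c)) (by simp only [BinForm.disc]; ring)
    rw [Matrix.det_fin_two_of]
    linear_combination this⟩

/-- A loxodromic element of `SL₂(𝒪_d)` that is not a proper power. -/
def IsPrimitiveLoxodromic (B : SL(2, Od d)) : Prop :=
  IsLoxodromic (embSL d B) ∧ ∀ (A : SL(2, Od d)) (n : ℕ), 0 < n → B = A ^ n → n = 1 ∧ B = A

end HypKiss

end

/-! Let `t`, `u` be the solution with index `m`. For a form `Q` of discriminant `D`, the power `ε_Q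
^ (m + 1)` is the automorph attached to `(t, u)`. Modulo `u` it is the scalar `τ`, so it lies in
`Γ`, and its trace is `t`.

Conversely, `det g = 1` forces the trace of any `g` in `Γ` to be congruent to `2` or to `t` modulo
`u ^ 2` (`trace_dichotomy`). Nonzero elements of `𝒪_d` have modulus at least one, so a trace other
than `2` and `t` has modulus at least `|u|² - max(2, |t|)`, hence at least `5/9 |u|²`: this is what
the definition of `m` is made for. The bound `|D| > 51` makes `|u|²` large and `|t| > 2`.

An element of trace `τ` moves every point by a distance whose `cosh` is at least `(|τ|² + |τ² - 4|)
/ 4` (`H3.le_cosh_hdist_smul`), with equality on the axis of a loxodromic element. Among the traces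
in `Γ` other than `2` this quantity is minimal at `t` (`trace_estimate`), and elements of trace `2`
translate no geodesic. So the systole is `2 log |ε_D ^ (m + 1)|`, and every form of discriminant `D`
gives a closed geodesic of that length. The same trace estimates show that `Γ` is torsion-free and
acts freely.

For the count, freely homotopic closed geodesics come from elements conjugate in `Γ`
(`exists_conj_of_freeClass_eq`), and forms whose automorphs for the same `(t, u)` with `u ≠ 0` are
conjugate in `SL₂(𝒪_d)` are equivalent (`equivalent_of_automorph_mul_eq`). Primitivity of `ε_Q`
holds because the centralizer of an automorph of a primitive form consists of automorphs
(`exists_eq_automorph_of_commute`), so that a root of `ε_Q` would be a smaller Pell solution. -/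

noncomputable section

namespace HypKiss

/-! ## The Hermitian model of hyperbolic space -/

namespace H3

theorem coe_t_ne (p : H3) : (p.t : ℂ) ≠ 0 := Complex.ofReal_ne_zero.mpr p.t_pos.ne'

/-- The positive definite Hermitian matrix of determinant one attached to a point. -/
def herm (p : H3) : Matrix (Fin 2) (Fin 2) ℂ :=
  !![(p.z * conj p.z + (p.t : ℂ) ^ 2) / p.t, p.z / p.t; conj p.z / p.t, 1 / p.t]

/-- The bilinear form on `2 × 2` matrices polarizing the determinant. -/
def bil (P Q : Matrix (Fin 2) (Fin 2) ℂ) : ℂ :=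
  (P 0 0 * Q 1 1 + P 1 1 * Q 0 0 - P 0 1 * Q 1 0 - P 1 0 * Q 0 1) / 2

/-- In the Hermitian model the Poincaré extension becomes linear; distances and displacements reduce
to matrix algebra. -/
theorem herm_smul (g : SL(2, ℂ)) (p : H3) :
    herm (g • p) = (g : Matrix (Fin 2) (Fin 2) ℂ) * herm p
      * (g : Matrix (Fin 2) (Fin 2) ℂ).conjTranspose := by
  have ht := coe_t_ne p
  have hD := den_coe_ne g p
  have e1 := smul_normSq g p
  have e2 := smul_z_mul_den g p
  have e3 := smul_z_conj_mul_den g p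
  have e4 := den_coe g p
  have e5 : ((g • p).t : ℂ) = p.t / den g p := by rw [smul_t, Complex.ofReal_div]
  have hdiv : ∀ x : ℂ, x / ((g • p).t : ℂ) = x * den g p / p.t := by
    intro x; rw [e5]; field_simp
  ext i j
  fin_cases i <;> fin_cases j <;>
    simp only [herm, hdiv, Matrix.mul_apply, Fin.sum_univ_two, Matrix.conjTranspose_apply,
      Fin.zero_eta, Fin.mk_one, Matrix.of_apply, Matrix.cons_val', Matrix.cons_val_zero,
      Matrix.cons_val_one, Matrix.cons_val_fin_one, starRingEnd_apply] at *
  · rw [e1]; field_simp; simp only [star_add, star_mul']; ring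
  · rw [e2]; field_simp; simp only [star_add, star_mul']; ring
  · rw [e3]; field_simp; simp only [star_add, star_mul']; ring
  · rw [one_mul, e4]; field_simp; simp only [star_add, star_mul']; ring

theorem herm_inj {p q : H3} (h : herm p = herm q) : p = q := by
  have h1 := congrFun (congrFun h 1) 1
  have h0 := congrFun (congrFun h 0) 1
  simp only [herm, Matrix.of_apply, Matrix.cons_val', Matrix.cons_val_zero,
      Matrix.cons_val_one, Matrix.cons_val_fin_one, one_div, inv_inj, Complex.ofReal_inj] at h0 h1
  refine H3.ext ?_ h1
  rw [h1] at h0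
  exact (div_left_inj' (coe_t_ne q)).mp h0

theorem bil_conj (g : SL(2, ℂ)) (P Q : Matrix (Fin 2) (Fin 2) ℂ) :
    bil ((g : Matrix (Fin 2) (Fin 2) ℂ) * P * (g : Matrix (Fin 2) (Fin 2) ℂ).conjTranspose)
      ((g : Matrix (Fin 2) (Fin 2) ℂ) * Q * (g : Matrix (Fin 2) (Fin 2) ℂ).conjTranspose)
      = bil P Q := by
  have hd : g 0 0 * g 1 1 - g 0 1 * g 1 0 = 1 := by
    have := g.det_coe
    rwa [Matrix.det_fin_two] at this
  have hd' : star (g 0 0) * star (g 1 1) - star (g 0 1) * star (g 1 0) = 1 := by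
    simpa using congrArg star hd
  have : bil ((g : Matrix (Fin 2) (Fin 2) ℂ) * P
        * (g : Matrix (Fin 2) (Fin 2) ℂ).conjTranspose)
      ((g : Matrix (Fin 2) (Fin 2) ℂ) * Q * (g : Matrix (Fin 2) (Fin 2) ℂ).conjTranspose)
      = (g 0 0 * g 1 1 - g 0 1 * g 1 0)
        * (star (g 0 0) * star (g 1 1) - star (g 0 1) * star (g 1 0)) * bil P Q := by
    simp only [bil, Matrix.mul_apply, Fin.sum_univ_two, Matrix.conjTranspose_apply]
    ring
  rw [this, hd, hd', one_mul, one_mul]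

/-! ### Distance and displacement in the Hermitian model. -/

theorem hdist_nonneg (p q : H3) : 0 ≤ hdist p q := by
  unfold hdist
  have := Real.arsinh_nonneg_iff.mpr
    (show 0 ≤ √(‖p.z - q.z‖ ^ 2 + (p.t - q.t) ^ 2) / (2 * √(p.t * q.t)) by positivity)
  linarith

theorem cosh_hdist (p q : H3) : Real.cosh (hdist p q) =
    (‖p.z - q.z‖ ^ 2 + p.t ^ 2 + q.t ^ 2) / (2 * (p.t * q.t)) := by
  have hp := p.t_pos
  have hq := q.t_pos
  rw [hdist, Real.cosh_two_mul, Real.cosh_sq, Real.sinh_arsinh, div_pow, mul_pow,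
    Real.sq_sqrt (by positivity), Real.sq_sqrt (by positivity)]
  field_simp
  ring

/-- The points form a sheet of the hyperboloid `det = 1`, and `bil` is its Lorentzian inner product.
-/
theorem coe_cosh_hdist (p q : H3) :
    (Real.cosh (hdist p q) : ℂ) = bil (herm p) (herm q) := by
  have hp := coe_t_ne p
  have hq := coe_t_ne q
  rw [cosh_hdist]
  push_cast
  rw [← Complex.mul_conj']
  simp only [bil, herm, Matrix.of_apply, Matrix.cons_val', Matrix.cons_val_zero,
      Matrix.cons_val_one, Matrix.cons_val_fin_one, map_sub]
  field_simp
  ring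

theorem cosh_hdist_injective {p q p' q' : H3}
    (h : bil (herm p) (herm q) = bil (herm p') (herm q')) : hdist p q = hdist p' q' := by
  rw [← coe_cosh_hdist, ← coe_cosh_hdist, Complex.ofReal_inj] at h
  exact Real.cosh_strictMonoOn.injOn (hdist_nonneg _ _) (hdist_nonneg _ _) h

theorem hdist_smul (g : SL(2, ℂ)) (p q : H3) : hdist (g • p) (g • q) = hdist p q := by
  apply cosh_hdist_injective
  rw [herm_smul, herm_smul, bil_conj]

/-- The point at height `s` above the origin. -/
def axisPoint (s : ℝ) : H3 := mk 0 (Real.exp s) (Real.exp_pos s)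

@[simp] theorem axisPoint_z (s : ℝ) : (axisPoint s).z = 0 := rfl

@[simp] theorem axisPoint_t (s : ℝ) : (axisPoint s).t = Real.exp s := rfl

/-- The base point is the identity matrix, so its image under `g` is `g g*`, and `bil 1` is half the
trace. -/
theorem cosh_hdist_axisPoint_smul (g : SL(2, ℂ)) :
    Real.cosh (hdist (axisPoint 0) (g • axisPoint 0)) =
      (‖g 0 0‖ ^ 2 + ‖g 0 1‖ ^ 2 + ‖g 1 0‖ ^ 2 + ‖g 1 1‖ ^ 2) / 2 := by
  apply Complex.ofReal_injective
  have : herm (axisPoint 0) = 1 := by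
    ext i j
    fin_cases i <;> fin_cases j <;> simp [herm]
  rw [coe_cosh_hdist, herm_smul, this, mul_one]
  push_cast
  simp only [← Complex.mul_conj', bil, Matrix.mul_apply, Fin.sum_univ_two,
    Matrix.conjTranspose_apply, starRingEnd_apply]
  simp
  ring

theorem exists_smul_axisPoint (p : H3) : ∃ h : SL(2, ℂ), h • axisPoint 0 = p := by
  have hp : (0 : ℝ) < √p.t := Real.sqrt_pos.mpr p.t_pos
  have hp' : ((√p.t : ℝ) : ℂ) ≠ 0 := Complex.ofReal_ne_zero.mpr hp.ne'
  have hs : √p.t ^ 2 = p.t := Real.sq_sqrt p.t_pos.le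
  have hdet : (!![(√p.t : ℂ), p.z / √p.t; 0, 1 / √p.t]).det = 1 := by
    rw [Matrix.det_fin_two_of, mul_zero, sub_zero, mul_one_div_cancel hp']
  obtain ⟨g, hg⟩ : ∃ g : SL(2, ℂ),
      (g : Matrix (Fin 2) (Fin 2) ℂ) = !![(√p.t : ℂ), p.z / √p.t; 0, 1 / √p.t] := ⟨⟨_, hdet⟩, rfl⟩
  have hden : den g (axisPoint 0) = 1 / p.t := by
    simp [den, hg, inv_pow, hs]
  refine ⟨g, H3.ext ?_ ?_⟩
  · rw [smul_z, hden, hg]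
    have : (p.t : ℂ) = (√p.t : ℂ) ^ 2 := by exact_mod_cast congrArg Complex.ofReal hs.symm
    have ht : (p.t : ℂ) ≠ 0 := coe_t_ne p
    simp only [Matrix.of_apply, Matrix.cons_val', Matrix.cons_val_zero, Matrix.cons_val_one,
      Matrix.cons_val_fin_one, axisPoint_z, mul_zero, zero_add, map_div₀, map_one,
      Complex.conj_ofReal, map_zero, zero_mul, add_zero, Complex.ofReal_div, Complex.ofReal_one,
      div_mul_div_comm, mul_one, div_div_eq_mul_div, div_one]
    rw [ ← sq, ← this]
    exact div_mul_cancel₀ _ ht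
  · rw [smul_t, hden]
    simp

/-- The displacement of a point is the Frobenius norm of a conjugate. -/
theorem exists_cosh_hdist_smul (g : SL(2, ℂ)) (p : H3) : ∃ h : SL(2, ℂ), ∀ A, A = h⁻¹ * g * h →
    Real.cosh (hdist p (g • p)) =
      (‖A 0 0‖ ^ 2 + ‖A 0 1‖ ^ 2 + ‖A 1 0‖ ^ 2 + ‖A 1 1‖ ^ 2) / 2 := by
  obtain ⟨h, rfl⟩ := exists_smul_axisPoint p
  refine ⟨h, ?_⟩
  rintro A rfl
  rw [← cosh_hdist_axisPoint_smul, ← hdist_smul h (axisPoint 0) ((h⁻¹ * g * h) • axisPoint 0)]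
  simp only [← mul_smul]
  rw [show h * (h⁻¹ * g * h) = g * h by group]

theorem trace_conj (g h : SL(2, ℂ)) :
    ((h⁻¹ * g * h : SL(2, ℂ)) : Matrix (Fin 2) (Fin 2) ℂ).trace
      = (g : Matrix (Fin 2) (Fin 2) ℂ).trace := by
  rw [Matrix.SpecialLinearGroup.coe_mul, Matrix.trace_mul_comm,
    ← Matrix.SpecialLinearGroup.coe_mul]
  rw [show h * (h⁻¹ * g) = g by group]

/-- The displacement is bounded below in terms of the trace. -/
theorem le_cosh_hdist_smul (g : SL(2, ℂ)) (p : H3) {τ : ℂ}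
    (hτ : (g : Matrix (Fin 2) (Fin 2) ℂ).trace = τ) :
    (‖τ‖ ^ 2 + ‖τ ^ 2 - 4‖) / 4 ≤ Real.cosh (hdist p (g • p)) := by
  obtain ⟨h, hh⟩ := exists_cosh_hdist_smul g p
  rw [hh _ rfl]
  rw [← trace_conj g h] at hτ
  generalize h⁻¹ * g * h = A at *
  have hd := A.det_coe
  rw [Matrix.det_fin_two] at hd
  rw [Matrix.trace_fin_two] at hτ
  -- The discriminant of the characteristic polynomial is `(a - d)² + 4bc`. The parallelogram law
  -- controls the diagonal and `2|bc| ≤ |b|² + |c|²` the rest.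
  have e1 : τ ^ 2 - 4 = (A 0 0 - A 1 1) ^ 2 + 4 * (A 0 1 * A 1 0) := by
    rw [← hτ]; linear_combination 4 * hd
  have e2 : ‖τ ^ 2 - 4‖ ≤ ‖A 0 0 - A 1 1‖ ^ 2 + 4 * (‖A 0 1‖ * ‖A 1 0‖) := by
    rw [e1]
    refine (norm_add_le _ _).trans_eq ?_
    simp
  have e3 := parallelogram_law_with_norm ℝ (A 0 0) (A 1 1)
  rw [← hτ]
  rw [← hτ] at e2
  nlinarith [sq_nonneg (‖A 0 1‖ - ‖A 1 0‖)]

/-- An element of trace two with a fixed point is trivial. -/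
theorem eq_one_of_smul_eq {g : SL(2, ℂ)} {p : H3} (hp : g • p = p)
    (hg : (g : Matrix (Fin 2) (Fin 2) ℂ).trace = 2) : g = 1 := by
  obtain ⟨h, hh⟩ := exists_cosh_hdist_smul g p
  have h1 := hh _ rfl
  rw [hp] at h1
  have h0 : hdist p p = 0 := by simp [hdist]
  rw [h0, Real.cosh_zero] at h1
  rw [← trace_conj g h] at hg
  suffices hA : h⁻¹ * g * h = 1 by
    have : g = h * (h⁻¹ * g * h) * h⁻¹ := by group
    rw [this, hA]; group
  generalize h⁻¹ * g * h = A at *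
  rw [Matrix.trace_fin_two] at hg
  have hre := congrArg Complex.re hg
  have e : ∀ w : ℂ, ‖w - 1‖ ^ 2 = ‖w‖ ^ 2 - 2 * w.re + 1 := by
    intro w
    rw [← Complex.normSq_eq_norm_sq, ← Complex.normSq_eq_norm_sq, Complex.normSq_apply,
      Complex.normSq_apply]
    simp; ring
  have h00 := e (A 0 0)
  have h11 := e (A 1 1)
  simp at hre
  -- Zero displacement makes the squared Frobenius norm of `A` equal to `2`; with trace `2`, that of
  -- `A - 1` is `2 - 4 + 2 = 0`.
  have k0 : ‖A 0 0 - 1‖ = 0 := by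
    nlinarith [sq_nonneg ‖A 0 0 - 1‖, sq_nonneg ‖A 1 1 - 1‖, sq_nonneg ‖A 0 1‖, sq_nonneg ‖A 1 0‖]
  have k1 : ‖A 1 1 - 1‖ = 0 := by
    nlinarith [sq_nonneg ‖A 0 0 - 1‖, sq_nonneg ‖A 1 1 - 1‖, sq_nonneg ‖A 0 1‖, sq_nonneg ‖A 1 0‖]
  have k2 : ‖A 0 1‖ = 0 := by
    nlinarith [sq_nonneg ‖A 0 0 - 1‖, sq_nonneg ‖A 1 1 - 1‖, sq_nonneg ‖A 0 1‖, sq_nonneg ‖A 1 0‖]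
  have k3 : ‖A 1 0‖ = 0 := by
    nlinarith [sq_nonneg ‖A 0 0 - 1‖, sq_nonneg ‖A 1 1 - 1‖, sq_nonneg ‖A 0 1‖, sq_nonneg ‖A 1 0‖]
  rw [norm_eq_zero] at k0 k1 k2 k3
  apply Subtype.ext
  ext i j
  fin_cases i <;> fin_cases j <;> simp [sub_eq_zero.mp k0, sub_eq_zero.mp k1, k2, k3]

end H3

namespace H3

/-! ## Geodesics -/

theorem bil_comm (P Q : Matrix (Fin 2) (Fin 2) ℂ) : bil P Q = bil Q P := by
  unfold bil; ring

theorem bil_lincomb (P X Y Z : Matrix (Fin 2) (Fin 2) ℂ) (x y : ℂ) :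
    bil P (Z - x • X - y • Y) = bil P Z - x * bil P X - y * bil P Y := by
  simp only [bil, Matrix.sub_apply, Matrix.smul_apply, smul_eq_mul]
  ring

/-- The determinant has signature `(1, 3)` on Hermitian matrices and is positive at `herm p`, hence
it is negative definite on the orthogonal complement of `herm p`. -/
theorem eq_zero_of_bil_eq_zero {V : Matrix (Fin 2) (Fin 2) ℂ} (p : H3) (hV : V.IsHermitian)
    (h0 : bil V V = 0) (h1 : bil (herm p) V = 0) : V = 0 := by
  have hc : V 1 0 = conj (V 0 1) := (hV.apply 1 0).symm
  obtain ⟨r, hr⟩ : ∃ r : ℝ, V 0 0 = r :=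
    ⟨_, (Complex.conj_eq_iff_re.mp (hV.apply 0 0)).symm⟩
  obtain ⟨s, hs⟩ : ∃ s : ℝ, V 1 1 = s :=
    ⟨_, (Complex.conj_eq_iff_re.mp (hV.apply 1 1)).symm⟩
  set q := V 0 1 with hq
  have ht := coe_t_ne p
  have hrs : (r : ℂ) * s = q * conj q := by
    simp only [bil, hc, hr, hs, ← hq] at h0
    linear_combination h0
  have h2 : (s * p.z - q) * conj (s * p.z - q) + (p.t : ℂ) ^ 2 * s ^ 2 = 0 := by
    simp only [bil, herm, Matrix.of_apply, Matrix.cons_val', Matrix.cons_val_zero,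
      Matrix.cons_val_one, Matrix.cons_val_fin_one, hc, hr, hs, ← hq] at h1
    field_simp at h1
    simp only [map_sub, map_mul, Complex.conj_ofReal]
    linear_combination s * h1 - hrs
  rw [Complex.mul_conj'] at h2
  have h3 : ‖s * p.z - q‖ ^ 2 + p.t ^ 2 * s ^ 2 = 0 := by exact_mod_cast h2
  have h4 : p.t ^ 2 * s ^ 2 = 0 := by
    nlinarith [sq_nonneg ‖s * p.z - q‖, mul_nonneg (sq_nonneg p.t) (sq_nonneg s)]
  have hs0 : s = 0 := by
    simpa [p.t_pos.ne'] using h4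
  have hq0 : q = 0 := by
    rw [hs0] at h3
    simpa using h3
  have hr0 : r = 0 := by
    have : bil (herm p) V = r / p.t / 2 := by
      simp only [bil, herm, Matrix.of_apply, Matrix.cons_val', Matrix.cons_val_zero,
        Matrix.cons_val_one, Matrix.cons_val_fin_one, hc, hr, hs, ← hq, hs0, hq0]
      simp
      ring
    rw [h1] at this
    simpa [ht] using this.symm
  ext i j
  fin_cases i <;> fin_cases j <;> simp [hr, hs, hc, ← hq, hs0, hq0, hr0]

theorem isHermitian_herm (p : H3) : (herm p).IsHermitian := by
  ext i j
  fin_cases i <;> fin_cases j <;>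
    simp [herm, mul_comm]

/-- Two points of a geodesic line determine all others. -/
theorem IsGeodesicLine.herm_eq {c : ℝ → H3} (hc : IsGeodesicLine c) {a b : ℝ} (hab : a ≠ b)
    (s : ℝ) : herm (c s) = ((Real.sinh (b - s) / Real.sinh (b - a) : ℝ) : ℂ) • herm (c a)
      + ((Real.sinh (s - a) / Real.sinh (b - a) : ℝ) : ℂ) • herm (c b) := by
  have hB : ∀ x y, bil (herm (c x)) (herm (c y)) = (Real.cosh (y - x) : ℝ) := by
    intro x y
    rw [← coe_cosh_hdist, hc, Real.cosh_abs, ← Real.cosh_neg, neg_sub]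
  have hS : Real.sinh (b - a) ≠ 0 := by
    rw [Ne, Real.sinh_eq_zero, sub_eq_zero]
    exact hab.symm
  set α := Real.sinh (b - s) / Real.sinh (b - a) with hα
  set β := Real.sinh (s - a) / Real.sinh (b - a) with hβ
  have e1 : b - a = (b - s) + (s - a) := by ring
  -- `k1`, `k2`, `k3` say that the difference of the two sides is orthogonal to the points at `a`,
  -- `b` and `s`. It is then orthogonal to itself, and `eq_zero_of_bil_eq_zero` applies.
  have k1 : Real.cosh (s - a) - α * 1 - β * Real.cosh (b - a) = 0 := by
    rw [hα, hβ]
    field_simp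
    rw [e1, Real.sinh_add, Real.cosh_add]
    linear_combination Real.sinh (b - s) * Real.cosh_sq (s - a)
  have k2 : Real.cosh (b - s) - α * Real.cosh (b - a) - β * 1 = 0 := by
    rw [hα, hβ]
    field_simp
    rw [e1, Real.sinh_add, Real.cosh_add]
    linear_combination Real.sinh (s - a) * Real.cosh_sq (b - s)
  have k3 : 1 - α * Real.cosh (s - a) - β * Real.cosh (b - s) = 0 := by
    rw [hα, hβ]
    field_simp
    rw [e1, Real.sinh_add]
    ring
  have hV : herm (c s) - (α : ℂ) • herm (c a) - (β : ℂ) • herm (c b) = 0 := by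
    have b1 : bil (herm (c a)) (herm (c s) - (α : ℂ) • herm (c a) - (β : ℂ) • herm (c b)) = 0 := by
      rw [bil_lincomb, hB, hB, hB, sub_self, Real.cosh_zero]
      exact_mod_cast k1
    have b2 : bil (herm (c b)) (herm (c s) - (α : ℂ) • herm (c a) - (β : ℂ) • herm (c b)) = 0 := by
      rw [bil_lincomb, hB, hB, hB, sub_self, Real.cosh_zero, ← Real.cosh_neg, neg_sub,
        ← Real.cosh_neg (a - b), neg_sub]
      exact_mod_cast k2
    have b3 : bil (herm (c s)) (herm (c s) - (α : ℂ) • herm (c a) - (β : ℂ) • herm (c b)) = 0 := by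
      rw [bil_lincomb, hB, hB, hB, sub_self, Real.cosh_zero, ← Real.cosh_neg (a - s), neg_sub]
      exact_mod_cast k3
    refine eq_zero_of_bil_eq_zero (c a) ?_ ?_ b1
    · unfold Matrix.IsHermitian
      simp only [Matrix.conjTranspose_sub, Matrix.conjTranspose_smul,
        (isHermitian_herm _).eq, ← starRingEnd_apply, Complex.conj_ofReal]
    · rw [bil_lincomb, bil_comm _ (herm (c s)), bil_comm _ (herm (c a)), bil_comm _ (herm (c b)),
        b1, b2, b3]
      ring
  rw [sub_sub, sub_eq_zero] at hV
  exact hV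

theorem IsGeodesicLine.eq_of_eq {c c' : ℝ → H3} (hc : IsGeodesicLine c) (hc' : IsGeodesicLine c')
    {a b : ℝ} (hab : a ≠ b) (ha : c a = c' a) (hb : c b = c' b) (s : ℝ) : c s = c' s := by
  apply herm_inj
  rw [hc.herm_eq hab, hc'.herm_eq hab, ha, hb]

theorem IsGeodesicLine.smul {c : ℝ → H3} (hc : IsGeodesicLine c) (g : SL(2, ℂ)) :
    IsGeodesicLine fun s => g • c s := fun s s' => by
  rw [hdist_smul, hc]

theorem IsGeodesicLine.shift {c : ℝ → H3} (hc : IsGeodesicLine c) (L : ℝ) :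
    IsGeodesicLine fun s => c (s + L) := fun s s' => by
  rw [hc, add_sub_add_right_eq_sub]

/-- An element of trace two does not translate a geodesic line. -/
theorem trace_ne_two_of_translation {c : ℝ → H3} (hc : IsGeodesicLine c) {g : SL(2, ℂ)} {L : ℝ}
    (hL : 0 < L) (h : ∀ s, g • c s = c (s + L)) :
    (g : Matrix (Fin 2) (Fin 2) ℂ).trace ≠ 2 := by
  intro htr
  set G : Matrix (Fin 2) (Fin 2) ℂ := g.1 with hG
  -- By Cayley–Hamilton `G` is unipotent, so `Gⁿ P G*ⁿ` is quadratic in `n` and its third difference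
  -- vanishes; this is `key`.
  have hsq : G * G = G + G - 1 := by
    have hd := g.det_coe
    rw [Matrix.det_fin_two] at hd
    rw [Matrix.trace_fin_two] at htr
    ext i j
    fin_cases i <;> fin_cases j <;> simp [Matrix.mul_apply, Fin.sum_univ_two]
    · linear_combination G 0 0 * htr - hd
    · linear_combination G 0 1 * htr
    · linear_combination G 1 0 * htr
    · linear_combination G 1 1 * htr - hd
  have hsq' : G.conjTranspose * G.conjTranspose = G.conjTranspose + G.conjTranspose - 1 := by
    rw [← Matrix.conjTranspose_mul, hsq]
    simp [Matrix.conjTranspose_sub]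
  have hstep : ∀ s, herm (c (s + L)) = G * herm (c s) * G.conjTranspose := by
    intro s; rw [← h, herm_smul]
  have p1 := hstep 0
  have p2 := hstep (0 + L)
  have p3 := hstep (0 + L + L)
  set P := herm (c 0) with hP
  set P1 := herm (c (0 + L)) with hP1
  set P2 := herm (c (0 + L + L)) with hP2
  have q2 : P2 = (G + G - 1) * P * (G.conjTranspose + G.conjTranspose - 1) := by
    rw [p2, p1, ← hsq, ← hsq']
    simp only [mul_assoc]
  have key : herm (c (0 + L + L + L)) = P2 + P2 + P2 - P1 - P1 - P1 + P := by
    have : herm (c (0 + L + L + L)) = G * (G + G - 1) * P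
        * ((G.conjTranspose + G.conjTranspose - 1) * G.conjTranspose) := by
      rw [p3, q2]
      simp only [mul_assoc]
    have hcub : G * (G + G - 1) = G + G + G - 1 - 1 := by
      rw [mul_sub, mul_add, hsq]; noncomm_ring
    have hcub' : (G.conjTranspose + G.conjTranspose - 1) * G.conjTranspose
        = G.conjTranspose + G.conjTranspose + G.conjTranspose - 1 - 1 := by
      rw [sub_mul, add_mul, hsq']; noncomm_ring
    rw [this, q2, p1, hcub, hcub']
    noncomm_ring
  have hB : ∀ x, bil P (herm (c x)) = (Real.cosh x : ℝ) := by
    intro x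
    rw [hP, ← coe_cosh_hdist, hc, Real.cosh_abs, zero_sub, Real.cosh_neg]
  have hfin : bil P (herm (c (0 + L + L + L))) = 3 * bil P P2 - 3 * bil P P1 + bil P P := by
    rw [key]
    simp only [bil, Matrix.sub_apply, Matrix.add_apply]
    ring
  rw [hP1, hP2, hB, hB, hB, hP, ← hP, hB] at hfin
  have hfin' : Real.cosh (3 * L) = 3 * Real.cosh (2 * L) - 3 * Real.cosh L + 1 := by
    have e3 : 0 + L + L + L = 3 * L := by ring
    have e2 : 0 + L + L = 2 * L := by ring
    rw [e3, e2, zero_add, Real.cosh_zero] at hfin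
    exact_mod_cast hfin
  -- With `x = cosh L` the relation reads `2 (x - 1)² (2x + 1) = 0`, impossible for `x > 1`.
  rw [Real.cosh_three_mul, Real.cosh_two_mul, Real.sinh_sq] at hfin'
  have h1 : 1 < Real.cosh L := Real.one_lt_cosh.mpr hL.ne'
  nlinarith [mul_pos (mul_pos (sub_pos.mpr h1) (sub_pos.mpr h1)) (sub_pos.mpr h1),
    mul_pos (sub_pos.mpr h1) (sub_pos.mpr h1)]

theorem cosh_translation {c : ℝ → H3} (hc : IsGeodesicLine c) {g : SL(2, ℂ)} {L : ℝ}
    (h : ∀ s, g • c s = c (s + L)) : Real.cosh (hdist (c 0) (g • c 0)) = Real.cosh L := by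
  rw [h, hc, Real.cosh_abs, zero_add, zero_sub, Real.cosh_neg]

end H3

/-! ### Lifting closed geodesics to translations. -/

theorem proj_eq_iff {Γ : Subgroup SL(2, ℂ)} {p q : H3} :
    proj Γ p = proj Γ q ↔ ∃ g ∈ Γ, g • q = p := by
  unfold proj
  rw [Quotient.eq'']
  change p ∈ MulAction.orbit Γ q ↔ _
  constructor
  · rintro ⟨g, rfl⟩
    exact ⟨g, g.2, rfl⟩
  · rintro ⟨g, hg, rfl⟩
    exact ⟨⟨g, hg⟩, rfl⟩

/-- A closed geodesic of the quotient by a countable group lifts to the axis of a translation. -/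
theorem IsClosedGeodesic.exists_translation {Γ : Subgroup SL(2, ℂ)} [Countable Γ] {L : ℝ}
    {f : Loop (Quot3 Γ)} (hf : IsClosedGeodesic Γ L f) : 0 < L ∧ ∃ c : ℝ → H3,
      H3.IsGeodesicLine c ∧ ∃ g ∈ Γ, ∀ s, g • c s = c (s + L) := by
  obtain ⟨hL, c, hc, hfc⟩ := hf
  refine ⟨hL, c, hc, ?_⟩
  have hex : ∀ s : ℝ, ∃ g : Γ, g.1 • c (L * s) = c (L * s + L) := by
    intro s
    have : proj Γ (c (L * (s + 1))) = proj Γ (c (L * s)) := by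
      rw [← hfc, ← hfc, AddCircle.coe_add_period]
    obtain ⟨g, hg, h⟩ := proj_eq_iff.mp this
    exact ⟨⟨g, hg⟩, by rw [h]; congr 1; ring⟩
  choose γ hγ using hex
  -- The element of `Γ` may vary with `s`, but there are uncountably many `s`: some element serves
  -- two parameters, and two points determine the geodesic.
  have hni : ¬ Function.Injective γ := fun hinj => not_countable (hinj.countable : Countable ℝ)
  obtain ⟨a, b, hab, hne⟩ := Function.not_injective_iff.mp hni
  refine ⟨γ a, (γ a).2, ?_⟩
  refine (hc.smul (γ a).1).eq_of_eq (hc.shift L) (a := L * a) (b := L * b) ?_ (hγ a) ?_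
  · simpa [hL.ne'] using hne
  · rw [hab]; exact hγ b

/-! ## Axes of loxodromic elements -/

namespace H3

theorem isGeodesicLine_axisPoint : IsGeodesicLine axisPoint := by
  intro s s'
  apply Real.cosh_strictMonoOn.injOn (hdist_nonneg _ _) (Set.mem_Ici.mpr (abs_nonneg _))
  rw [cosh_hdist, Real.cosh_abs, Real.cosh_eq, axisPoint_t, axisPoint_t, axisPoint_z, axisPoint_z]
  have := Real.exp_pos s
  have := Real.exp_pos s'
  rw [neg_sub, Real.exp_sub, Real.exp_sub]
  simp
  field_simp

theorem continuous_z : Continuous z := continuous_fst.comp continuous_subtype_val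

theorem continuous_t : Continuous t := continuous_snd.comp continuous_subtype_val

theorem continuous_of_coords {X : Type*} [TopologicalSpace X] {f : X → H3}
    (hz : Continuous fun x => (f x).z) (ht : Continuous fun x => (f x).t) : Continuous f :=
  Continuous.subtype_mk (hz.prodMk ht) fun x => (f x).2

theorem continuous_den (g : SL(2, ℂ)) : Continuous (den g) := by
  have := continuous_z
  have := continuous_t
  unfold den
  fun_prop

instance : ContinuousConstSMul SL(2, ℂ) H3 where
  continuous_const_smul g := by
    have hz := continuous_z
    have ht := continuous_t
    have hd := continuous_den g
    apply continuous_of_coords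
    · simp only [smul_z]
      refine Continuous.div ?_ (Complex.continuous_ofReal.comp hd) (den_coe_ne g)
      have : Continuous fun p : H3 => (p.t : ℂ) := Complex.continuous_ofReal.comp ht
      have : Continuous fun p : H3 => conj (g 1 0 * p.z + g 1 1) :=
        Complex.continuous_conj.comp (by fun_prop)
      fun_prop
    · simp only [smul_t]
      exact ht.div hd fun p => (den_pos g p).ne'

theorem continuous_axisPoint : Continuous axisPoint :=
  continuous_of_coords continuous_const Real.continuous_exp

/-- A diagonalizable element with eigenvalue `μ` translates a geodesic by `2 log |μ|`. -/
theorem exists_axis {g : SL(2, ℂ)} {μ : ℂ} (hμ : 1 < ‖μ‖)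
    (htr : (g : Matrix (Fin 2) (Fin 2) ℂ).trace = μ + μ⁻¹) (h10 : g 1 0 ≠ 0) :
    ∃ c : ℝ → H3, IsGeodesicLine c ∧ Continuous c ∧
      ∀ s, g • c s = c (s + 2 * Real.log ‖μ‖) := by
  have hμ0 : μ ≠ 0 := by rintro rfl; simp at hμ; linarith
  have hdet := g.det_coe
  rw [Matrix.det_fin_two] at hdet
  rw [Matrix.trace_fin_two] at htr
  have hδ : μ - μ⁻¹ ≠ 0 := by
    intro h
    have h2 : ‖μ‖ = ‖μ‖⁻¹ := by rw [← norm_inv, ← sub_eq_zero.mp h]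
    have h3 : ‖μ‖⁻¹ < 1 := inv_lt_one_of_one_lt₀ hμ
    linarith
  -- The conjugating matrix has eigenvectors for `μ` and `μ⁻¹` as columns; dividing the first by `δ`
  -- makes the determinant one.
  set δ := g 1 0 * (μ - μ⁻¹) with hδdef
  have hδ0 : δ ≠ 0 := mul_ne_zero h10 hδ
  have hhdet : (!![(μ - g 1 1) / δ, μ⁻¹ - g 1 1; g 1 0 / δ, g 1 0]).det = 1 := by
    rw [Matrix.det_fin_two_of, div_mul_eq_mul_div, ← mul_div_assoc, ← sub_div,
      div_eq_one_iff_eq hδ0, hδdef]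
    ring
  obtain ⟨h, hh⟩ : ∃ h : SL(2, ℂ), (h : Matrix (Fin 2) (Fin 2) ℂ) =
    !![(μ - g 1 1) / δ, μ⁻¹ - g 1 1; g 1 0 / δ, g 1 0] := ⟨⟨_, hhdet⟩, rfl⟩
  have hDdet : (!![μ, 0; 0, μ⁻¹]).det = 1 := by
    rw [Matrix.det_fin_two_of, mul_inv_cancel₀ hμ0]; ring
  obtain ⟨D, hD⟩ : ∃ D : SL(2, ℂ), (D : Matrix (Fin 2) (Fin 2) ℂ) = !![μ, 0; 0, μ⁻¹] :=
    ⟨⟨_, hDdet⟩, rfl⟩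
  have hcomm : g * h = h * D := by
    have hμi : μ * μ⁻¹ = 1 := mul_inv_cancel₀ hμ0
    apply Subtype.ext
    rw [Matrix.SpecialLinearGroup.coe_mul, Matrix.SpecialLinearGroup.coe_mul]
    ext i j
    rw [hh, hD]
    generalize μ⁻¹ = ν at *
    fin_cases i <;> fin_cases j <;> simp [Matrix.mul_apply, Fin.sum_univ_two]
    · field_simp
      linear_combination μ * htr - hdet + hμi
    · linear_combination ν * htr - hdet + hμi
    · field_simp
      ring
    · ring
  have hDs : ∀ s, D • axisPoint s = axisPoint (s + 2 * Real.log ‖μ‖) := by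
    intro s
    have hn : ‖μ‖ ≠ 0 := norm_ne_zero_iff.mpr hμ0
    have hden : den D (axisPoint s) = (‖μ‖ ^ 2)⁻¹ := by
      simp [den, hD]
    refine H3.ext ?_ ?_
    · rw [smul_z]
      simp [hD]
    · rw [smul_t, hden, axisPoint_t, axisPoint_t, Real.exp_add, two_mul, Real.exp_add,
        Real.exp_log (by positivity)]
      field_simp
  refine ⟨fun s => h • axisPoint s, isGeodesicLine_axisPoint.smul h,
    continuous_axisPoint.const_smul h, fun s => ?_⟩
  simp only [← hDs, ← mul_smul, hcomm]

end H3

/-- A translation of a geodesic by an element of `Γ` determines a closed geodesic. -/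
theorem exists_isClosedGeodesicOf {Γ : Subgroup SL(2, ℂ)} {g : SL(2, ℂ)} (hg : g ∈ Γ) {L : ℝ}
    (hL : 0 < L) {c : ℝ → H3} (hc : H3.IsGeodesicLine c) (hcont : Continuous c)
    (h : ∀ s, g • c s = c (s + L)) : ∃ f, IsClosedGeodesicOf Γ g L f := by
  have hper : Function.Periodic (fun s : ℝ => proj Γ (c (L * s))) 1 := by
    intro s
    exact proj_eq_iff.mpr ⟨g, hg, by rw [h]; congr 1; ring⟩
  have hcf : Continuous fun s : ℝ => proj Γ (c (L * s)) :=
    continuous_quotient_mk'.comp (hcont.comp (by fun_prop))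
  refine ⟨⟨hper.lift, hcf.quotient_lift _⟩, hL, c, hc, h, fun s => ?_⟩
  exact hper.lift_coe s

theorem IsClosedGeodesicOf.isClosedGeodesic {Γ : Subgroup SL(2, ℂ)} {g : SL(2, ℂ)} {L : ℝ}
    {f : Loop (Quot3 Γ)} (h : IsClosedGeodesicOf Γ g L f) : IsClosedGeodesic Γ L f := by
  obtain ⟨hL, c, hc, -, hf⟩ := h
  exact ⟨hL, c, hc, hf⟩

/-! ## The ring of integers as a lattice in `ℂ` -/

section Lattice

variable {d : ℕ}

theorem sqrt_mul_I_sq (d : ℕ) : (((√(d : ℝ) : ℝ) : ℂ) * Complex.I) ^ 2 = -(d : ℂ) := by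
  have h : ((√(d : ℝ) : ℝ) : ℂ) ^ 2 = (d : ℂ) := by
    exact_mod_cast congrArg Complex.ofReal (Real.sq_sqrt (Nat.cast_nonneg d))
  rw [mul_pow, h, Complex.I_sq]
  ring

theorem exists_coords {x : ℂ} (hx : x ∈ kd d) :
    ∃ a b : ℚ, x = a + b * (((√(d : ℝ) : ℝ) : ℂ) * Complex.I) := by
  have hθ := sqrt_mul_I_sq d
  set θ := ((√(d : ℝ) : ℝ) : ℂ) * Complex.I with hθdef
  induction hx using IntermediateField.adjoin_induction with
  | mem x hx => exact ⟨0, 1, by simpa using hx⟩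
  | algebraMap q => exact ⟨q, 0, by simp⟩
  | add x y _ _ hx hy =>
    obtain ⟨a, b, rfl⟩ := hx
    obtain ⟨a', b', rfl⟩ := hy
    exact ⟨a + a', b + b', by push_cast; ring⟩
  | mul x y _ _ hx hy =>
    obtain ⟨a, b, rfl⟩ := hx
    obtain ⟨a', b', rfl⟩ := hy
    exact ⟨a * a' - d * b * b', a * b' + a' * b, by
      push_cast; linear_combination (b : ℂ) * b' * hθ⟩
  | inv x _ hx =>
    obtain ⟨a, b, rfl⟩ := hx
    by_cases h0 : (a : ℂ) + b * θ = 0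
    · exact ⟨0, 0, by rw [h0]; simp⟩
    · have hn : (a : ℂ) ^ 2 + d * b ^ 2 ≠ 0 := by
        intro h
        have h' : a ^ 2 + d * b ^ 2 = 0 := by exact_mod_cast h
        have ha : a = 0 := by
          have : (0 : ℚ) ≤ d * b ^ 2 := by positivity
          nlinarith [sq_nonneg a]
        have hb : (d : ℂ) * b ^ 2 = 0 := by
          rw [ha] at h; simpa using h
        apply h0
        have : ((a : ℂ) + b * θ) ^ 2 = 0 := by
          rw [ha, Rat.cast_zero, zero_add, mul_pow, hθ]
          linear_combination -hb
        simpa using this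
      refine ⟨a / (a ^ 2 + d * b ^ 2), -b / (a ^ 2 + d * b ^ 2), ?_⟩
      push_cast
      refine inv_eq_of_mul_eq_one_right ?_
      rw [div_mul_eq_mul_div, ← add_div, ← mul_div_assoc, div_eq_one_iff_eq hn]
      linear_combination -(b : ℂ) ^ 2 * hθ

/-- Trace and norm are rational by `exists_coords` and integral over `ℤ`. -/
theorem emb_add_conj_and_mul_conj (x : Od d) : (∃ m : ℤ, emb d x + conj (emb d x) = m) ∧
    ∃ n : ℤ, emb d x * conj (emb d x) = n := by
  obtain ⟨a, b, hab⟩ := exists_coords (d := d) (x := emb d x) (x : kd d).2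
  have hθ := sqrt_mul_I_sq d
  have hθc : conj (((√(d : ℝ) : ℝ) : ℂ) * Complex.I) = -(((√(d : ℝ) : ℝ) : ℂ) * Complex.I) := by
    simp
  set θ := ((√(d : ℝ) : ℝ) : ℂ) * Complex.I
  have hc : conj (emb d x) = a - b * θ := by
    rw [hab, map_add, map_mul, hθc]
    simp
    ring
  have hint : IsIntegral ℤ (emb d x) := by
    have : IsIntegral ℤ x := NumberField.RingOfIntegers.isIntegral x
    exact this.map (emb d).toIntAlgHom
  have hintc : IsIntegral ℤ (conj (emb d x)) := hint.map (starRingEnd ℂ).toIntAlgHom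
  have key : ∀ q : ℚ, IsIntegral ℤ (q : ℂ) → ∃ n : ℤ, (q : ℂ) = n := by
    intro q hq
    have : IsIntegral ℤ q :=
      (isIntegral_algebraMap_iff (A := ℚ) (B := ℂ) (algebraMap ℚ ℂ).injective).mp hq
    obtain ⟨n, hn⟩ := IsIntegrallyClosed.isIntegral_iff.mp this
    exact ⟨n, by rw [← hn]; simp⟩
  constructor
  · have e : emb d x + conj (emb d x) = ((2 * a : ℚ) : ℂ) := by
      rw [hc, hab]; push_cast; ring
    rw [e]
    exact key _ (e ▸ hint.add hintc)
  · have e : emb d x * conj (emb d x) = ((a ^ 2 + d * b ^ 2 : ℚ) : ℂ) := by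
      rw [hc, hab]; push_cast; linear_combination -(b : ℂ) ^ 2 * hθ
    rw [e]
    exact key _ (e ▸ hint.mul hintc)

/-- The squared modulus is a positive integer. Discreteness and the trace gap both rest on this
bound. -/
theorem one_le_norm_emb {x : Od d} (hx : x ≠ 0) : 1 ≤ ‖emb d x‖ := by
  obtain ⟨n, hn⟩ := (emb_add_conj_and_mul_conj x).2
  rw [Complex.mul_conj'] at hn
  have hn' : ‖emb d x‖ ^ 2 = n := by exact_mod_cast hn
  have h0 : 0 < ‖emb d x‖ := norm_pos_iff.mpr ((map_ne_zero_iff _ emb_inj).mpr hx)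
  have h1 : (0 : ℝ) < n := by rw [← hn']; positivity
  have h2 : (1 : ℝ) ≤ n := by exact_mod_cast h1
  rw [← hn'] at h2
  nlinarith

/-- Each such element is a root of one of finitely many polynomials `z² - mz + n`. -/
theorem finite_norm_emb_le (C : ℝ) : {x : Od d | ‖emb d x‖ ≤ C}.Finite := by
  refine Set.Finite.of_finite_image (f := emb d) ?_ emb_inj.injOn
  have hfin : (⋃ m ∈ Set.Icc (-⌈2 * C⌉) ⌈2 * C⌉, ⋃ n ∈ Set.Icc 0 ⌈C ^ 2⌉,
      {z : ℂ | z ^ 2 - (m : ℂ) * z + (n : ℂ) = 0}).Finite := by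
    refine (Set.finite_Icc _ _).biUnion fun m _ => (Set.finite_Icc _ _).biUnion fun n _ => ?_
    have hp : (Polynomial.X ^ 2 - Polynomial.C (m : ℂ) * Polynomial.X + Polynomial.C (n : ℂ)
        : Polynomial ℂ).Monic := by monicity!
    refine (Polynomial.finite_setOfPred_isRoot hp.ne_zero).subset fun z hz => ?_
    simpa [Polynomial.IsRoot] using hz
  refine hfin.subset ?_
  rintro _ ⟨x, hx, rfl⟩
  have hx' : ‖emb d x‖ ≤ C := hx
  obtain ⟨⟨m, hm⟩, n, hn⟩ := emb_add_conj_and_mul_conj x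
  have hn' : ‖emb d x‖ ^ 2 = n := by
    rw [Complex.mul_conj'] at hn
    exact_mod_cast hn
  have hm' : |(m : ℝ)| ≤ 2 * C := by
    have : ‖(m : ℂ)‖ ≤ 2 * C := by
      rw [← hm]
      refine (norm_add_le _ _).trans ?_
      rw [RCLike.norm_conj]; linarith
    simpa using this
  rw [abs_le] at hm'
  simp only [Set.mem_iUnion]
  refine ⟨m, ⟨?_, ?_⟩, n, ⟨?_, ?_⟩, ?_⟩
  · have h1 := Int.le_ceil (2 * C)
    have : (-⌈2 * C⌉ : ℝ) ≤ m := by linarith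
    exact_mod_cast this
  · have h1 := Int.le_ceil (2 * C)
    have : (m : ℝ) ≤ ⌈2 * C⌉ := by linarith
    exact_mod_cast this
  · have : (0 : ℝ) ≤ n := by rw [← hn']; positivity
    exact_mod_cast this
  · have h1 := Int.le_ceil (C ^ 2)
    have h2 : ‖emb d x‖ ^ 2 ≤ C ^ 2 := by gcongr
    have : (n : ℝ) ≤ ⌈C ^ 2⌉ := by linarith
    exact_mod_cast this
  · change emb d x ^ 2 - (m : ℂ) * emb d x + (n : ℂ) = 0
    rw [← hm, ← hn]; ring

instance countable_Od : Countable (Od d) := by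
  have : (⋃ n : ℕ, {x : Od d | ‖emb d x‖ ≤ n}) = Set.univ := by
    refine Set.eq_univ_of_forall fun x => ?_
    obtain ⟨n, hn⟩ := exists_nat_ge ‖emb d x‖
    exact Set.mem_iUnion.mpr ⟨n, hn⟩
  rw [← Set.countable_univ_iff, ← this]
  exact Set.countable_iUnion fun n => (finite_norm_emb_le _).countable

instance countable_SL : Countable SL(2, Od d) :=
  Function.Injective.countable (f := fun g : SL(2, Od d) =>
    (fun i j => g i j : Fin 2 → Fin 2 → Od d))
    fun _ _ e => Subtype.ext e

theorem embSL_apply (g : SL(2, Od d)) (i j : Fin 2) : embSL d g i j = emb d (g i j) := rfl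

theorem embSL_injective : Function.Injective (embSL d) := fun g h e => by
  refine Subtype.ext (Matrix.ext fun i j => ?_)
  exact emb_inj (congrFun (congrFun (congrArg Subtype.val e) i) j)

theorem embSL_trace (g : SL(2, Od d)) : (embSL d g : Matrix (Fin 2) (Fin 2) ℂ).trace
    = emb d (g : Matrix (Fin 2) (Fin 2) (Od d)).trace := by
  rw [Matrix.trace_fin_two, Matrix.trace_fin_two, map_add]; rfl

theorem finite_norm_embSL_le (C : ℝ) :
    {g : SL(2, Od d) | ∀ i j, ‖embSL d g i j‖ ≤ C}.Finite := by
  refine Set.Finite.of_finite_image (f := fun g : SL(2, Od d) =>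
    (fun i j => g i j : Fin 2 → Fin 2 → Od d)) ?_
    (fun g _ h _ e => Subtype.ext e)
  refine (Set.Finite.pi' fun i : Fin 2 => Set.Finite.pi' fun j : Fin 2 =>
    finite_norm_emb_le (d := d) C).subset ?_
  rintro _ ⟨g, hg, rfl⟩ i j
  exact hg i j

theorem discreteTopology_map_embSL (Γ : Subgroup SL(2, Od d)) :
    DiscreteTopology {A : Matrix (Fin 2) (Fin 2) ℂ //
      ∃ g ∈ Γ.map (embSL d), (g : Matrix (Fin 2) (Fin 2) ℂ) = A} := by
  rw [discreteTopology_iff_isOpen_singleton]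
  rintro ⟨A, g, ⟨g, hg, rfl⟩, rfl⟩
  have hopen : IsOpen {B : Matrix (Fin 2) (Fin 2) ℂ | ∀ i j, ‖B i j - embSL d g i j‖ < 1} := by
    simp only [Set.ofPred_forall]
    refine isOpen_iInter_of_finite fun i => isOpen_iInter_of_finite fun j => ?_
    exact isOpen_lt (by fun_prop) continuous_const
  convert hopen.preimage continuous_subtype_val
  ext ⟨B, h, ⟨h, hh, rfl⟩, rfl⟩
  simp only [Set.mem_singleton_iff, Subtype.mk.injEq, Set.mem_preimage, Set.mem_ofPred_eq]
  constructor
  · intro e i j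
    rw [e]; simp
  · intro e
    ext i j
    have := e i j
    rw [embSL_apply, embSL_apply, ← map_sub] at this
    by_contra hne
    refine absurd (one_le_norm_emb (x := h i j - g i j) ?_) (not_le.mpr this)
    rw [sub_ne_zero]
    intro e'
    exact hne (congrArg (emb d) e')

instance countable_map_embSL (Γ : Subgroup SL(2, Od d)) : Countable (Γ.map (embSL d)) :=
  ((Set.to_countable (Γ : Set SL(2, Od d))).image (embSL d)).to_subtype

end Lattice

/-! ## The covering of the quotient -/

namespace H3

instance : T2Space H3 := inferInstanceAs (T2Space {p : ℂ × ℝ // 0 < p.2})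

instance : LocallyCompactSpace H3 :=
  (isOpen_lt continuous_const continuous_snd : IsOpen {p : ℂ × ℝ | 0 < p.2}).locallyCompactSpace

/-- The quotient of the two heights is `den g p`, which bounds the bottom row; `smul_normSq` then
bounds the top row. This gives proper discontinuity. -/
theorem norm_entry_le {g : SL(2, ℂ)} {p : H3} {M : ℝ} (hM : 1 ≤ M) (hz : ‖p.z‖ ≤ M)
    (ht : p.t⁻¹ ≤ M) (ht' : p.t ≤ M) (hgz : ‖(g • p).z‖ ≤ M) (hgt : (g • p).t⁻¹ ≤ M)
    (hgt' : (g • p).t ≤ M) (i j : Fin 2) : ‖g i j‖ ≤ 4 * M ^ 4 := by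
  have hp := p.t_pos
  have hD := den_pos g p
  have hden : den g p ≤ M ^ 2 := by
    have e : den g p = p.t * (g • p).t⁻¹ := by
      rw [smul_t]; field_simp
    rw [e, sq]
    have := inv_pos.mpr (g • p).t_pos
    gcongr
  have hnum : ‖g 0 0 * p.z + g 0 1‖ ^ 2 + ‖g 0 0‖ ^ 2 * p.t ^ 2 ≤ (2 * M ^ 2) ^ 2 := by
    have e : ‖g 0 0 * p.z + g 0 1‖ ^ 2 + ‖g 0 0‖ ^ 2 * p.t ^ 2
        = (‖(g • p).z‖ ^ 2 + (g • p).t ^ 2) * den g p := by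
      have := smul_normSq g p
      rw [Complex.mul_conj', Complex.mul_conj', Complex.mul_conj'] at this
      exact_mod_cast this.symm
    have hgp := (g • p).t_pos
    have h1 : ‖(g • p).z‖ ^ 2 ≤ M ^ 2 := by gcongr
    have h2 : (g • p).t ^ 2 ≤ M ^ 2 := by gcongr
    calc _ = _ := e
      _ ≤ (M ^ 2 + M ^ 2) * M ^ 2 := by gcongr
      _ ≤ (2 * M ^ 2) ^ 2 := by nlinarith [sq_nonneg (M ^ 2)]
  have hM0 : 0 < M := by linarith
  have aux : ∀ x y : ℂ, ∀ B : ℝ, 0 ≤ B → ‖x * p.z + y‖ ^ 2 + ‖x‖ ^ 2 * p.t ^ 2 ≤ B ^ 2 →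
      ‖x‖ ≤ B * M ∧ ‖y‖ ≤ B + B * M * M := by
    intro x y B hB h
    have h1 : ‖x * p.z + y‖ ≤ B := by
      refine abs_le_of_sq_le_sq' ?_ hB |>.2
      nlinarith [mul_nonneg (sq_nonneg ‖x‖) (sq_nonneg p.t)]
    have h2 : ‖x‖ * p.t ≤ B := by
      refine abs_le_of_sq_le_sq' ?_ hB |>.2
      rw [mul_pow]
      nlinarith [sq_nonneg ‖x * p.z + y‖]
    have h3 : ‖x‖ ≤ B * M := by
      have : ‖x‖ = ‖x‖ * p.t * p.t⁻¹ := by field_simp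
      rw [this]
      have := inv_pos.mpr hp
      gcongr
    refine ⟨h3, ?_⟩
    have h4 : y = (x * p.z + y) - x * p.z := by ring
    rw [h4]
    refine (norm_sub_le _ _).trans ?_
    rw [norm_mul]
    gcongr
  obtain ⟨hc, hd⟩ := aux (g 1 0) (g 1 1) M hM0.le hden
  obtain ⟨ha, hb⟩ := aux (g 0 0) (g 0 1) (2 * M ^ 2) (by positivity) hnum
  have m1 : M ≤ M ^ 4 := le_self_pow₀ hM (by norm_num)
  have m2 : M ^ 2 ≤ M ^ 4 := pow_le_pow_right₀ hM (by norm_num)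
  have m3 : M ^ 3 ≤ M ^ 4 := pow_le_pow_right₀ hM (by norm_num)
  have m4 : 0 ≤ M ^ 4 := by positivity
  fin_cases i <;> fin_cases j <;> simp only [Fin.zero_eta, Fin.mk_one]
  · calc _ ≤ _ := ha
      _ = 2 * M ^ 3 := by ring
      _ ≤ _ := by linarith
  · calc _ ≤ _ := hb
      _ = 2 * M ^ 2 + 2 * M ^ 4 := by ring
      _ ≤ _ := by linarith
  · calc _ ≤ _ := hc
      _ = M ^ 2 := by ring
      _ ≤ _ := by linarith
  · calc _ ≤ _ := hd
      _ = M + M ^ 3 := by ring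
      _ ≤ _ := by linarith

theorem exists_bound_of_isCompact {K : Set H3} (hK : IsCompact K) :
    ∃ M, 1 ≤ M ∧ ∀ p ∈ K, ‖p.z‖ ≤ M ∧ p.t⁻¹ ≤ M ∧ p.t ≤ M := by
  have hz := continuous_z
  have ht := continuous_t
  have hti : Continuous fun p : H3 => p.t⁻¹ := ht.inv₀ fun p => p.t_pos.ne'
  have hcont : Continuous fun p : H3 => ‖p.z‖ + p.t⁻¹ + p.t := by fun_prop
  obtain ⟨M, hM⟩ := hK.bddAbove_image hcont.continuousOn
  refine ⟨max M 1, le_max_right _ _, fun p hp => ?_⟩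
  have h1 : ‖p.z‖ + p.t⁻¹ + p.t ≤ M := hM ⟨p, hp, rfl⟩
  have h2 := norm_nonneg p.z
  have h3 := p.t_pos
  have h4 := inv_pos.mpr h3
  have h5 := le_max_left M 1
  refine ⟨?_, ?_, ?_⟩ <;> linarith

instance {d : ℕ} (Γ : Subgroup SL(2, Od d)) :
    ProperlyDiscontinuousSMul (Γ.map (embSL d)) H3 where
  finite_disjoint_inter_image := by
    intro K L hK hL
    obtain ⟨M, hM, hb⟩ := exists_bound_of_isCompact (hK.union hL)
    refine Set.Finite.of_finite_image (f := Subtype.val) ?_ Subtype.val_injective.injOn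
    refine ((finite_norm_embSL_le (d := d) (4 * M ^ 4)).image (embSL d)).subset ?_
    rintro _ ⟨⟨_, g, hg, rfl⟩, hne, rfl⟩
    refine ⟨g, fun i j => ?_, rfl⟩
    obtain ⟨_, ⟨p, hp, rfl⟩, hq⟩ := hne
    obtain ⟨h1, h2, h3⟩ := hb p (Or.inl hp)
    obtain ⟨h4, h5, h6⟩ := hb _ (Or.inr hq)
    exact norm_entry_le hM h1 h2 h3 h4 h5 h6 i j

end H3

theorem isCoveringMap_proj {d : ℕ} {Γ : Subgroup SL(2, Od d)}
    (hfree : ∀ g ∈ Γ.map (embSL d), ∀ p : H3, g • p = p → g = 1) :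
    IsCoveringMap (proj (Γ.map (embSL d))) := by
  have : IsCancelSMul (Γ.map (embSL d)) H3 := by
    rw [isCancelSMul_iff_eq_one_of_smul_eq]
    rintro ⟨g, hg⟩ p h
    exact Subtype.ext (hfree g hg p h)
  have : ContinuousConstSMul (Γ.map (embSL d)) H3 := ⟨fun g => continuous_const_smul g.1⟩
  exact (isQuotientCoveringMap_quotientMk_of_properlyDiscontinuousSMul
    (G := Γ.map (embSL d)) (E := H3)).isCoveringMap

/-! ### Free homotopy and conjugacy. -/

theorem H3.IsGeodesicLine.continuous {c : ℝ → H3} (hc : H3.IsGeodesicLine c) : Continuous c := by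
  have hH : Continuous fun s => H3.herm (c s) := by
    rw [show (fun s => H3.herm (c s)) = _ from funext (hc.herm_eq (zero_ne_one' ℝ))]
    have h1 : Continuous fun s : ℝ => ((Real.sinh (1 - s) / Real.sinh (1 - 0) : ℝ) : ℂ) :=
      Complex.continuous_ofReal.comp
        ((Real.continuous_sinh.comp (by fun_prop)).div_const _)
    have h2 : Continuous fun s : ℝ => ((Real.sinh (s - 0) / Real.sinh (1 - 0) : ℝ) : ℂ) :=
      Complex.continuous_ofReal.comp
        ((Real.continuous_sinh.comp (by fun_prop)).div_const _)
    fun_prop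
  have h11 : Continuous fun s => (((c s).t : ℝ) : ℂ) := by
    have : (fun s => (((c s).t : ℝ) : ℂ)) = fun s => (H3.herm (c s) 1 1)⁻¹ := by
      funext s; simp [H3.herm]
    rw [this]
    refine Continuous.inv₀ (by fun_prop) fun s => ?_
    simp [H3.herm, (c s).t_pos.ne']
  have ht : Continuous fun s => (c s).t := by
    have := Complex.continuous_re.comp h11
    simpa [Function.comp_def] using this
  refine H3.continuous_of_coords ?_ ht
  have : (fun s => (c s).z) = fun s => H3.herm (c s) 0 1 * (((c s).t : ℝ) : ℂ) := by
    funext s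
    exact (div_mul_cancel₀ _ (H3.coe_t_ne _)).symm
  rw [this]
  fun_prop

/-- Freely homotopic closed geodesics are determined by conjugate elements. -/
theorem exists_conj_of_freeClass_eq {Γ : Subgroup SL(2, ℂ)} (cov : IsCoveringMap (proj Γ))
    (hfree : ∀ g ∈ Γ, ∀ p : H3, g • p = p → g = 1) {g g' : SL(2, ℂ)} (hg : g ∈ Γ) (hg' : g' ∈ Γ)
    {L L' : ℝ} {f f' : Loop (Quot3 Γ)} (hf : IsClosedGeodesicOf Γ g L f)
    (hf' : IsClosedGeodesicOf Γ g' L' f') (h : freeClass f = freeClass f') :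
    ∃ δ ∈ Γ, g * δ = δ * g' := by
  obtain ⟨F⟩ : ContinuousMap.Homotopic f f' := Quotient.exact h
  obtain ⟨-, c, hc, hgc, hfc⟩ := hf
  obtain ⟨-, c', hc', hgc', hfc'⟩ := hf'
  have hcov : Continuous fun s : ℝ => (s : UnitAddCircle) := AddCircle.continuous_mk' 1
  set H : C(unitInterval × ℝ, Quot3 Γ) :=
    ⟨fun x => F (x.1, (x.2 : UnitAddCircle)), by fun_prop⟩ with hH
  set e : C(ℝ, H3) := ⟨fun s => c (L * s), hc.continuous.comp (by fun_prop)⟩ with he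
  have H0 : ∀ s, H (0, s) = proj Γ (e s) := by
    intro s
    change F (0, (s : UnitAddCircle)) = _
    rw [F.apply_zero, hfc]
    rfl
  set G := cov.liftHomotopy H e H0 with hG
  have hGlift : ∀ x, proj Γ (G x) = H x := congrFun (cov.liftHomotopy_lifts H e H0)
  have hG0 : ∀ s, G (0, s) = c (L * s) := cov.liftHomotopy_zero H e H0
  -- the lifted homotopy is equivariant
  have hequiv : ∀ t, G (t, 1) = g • G (t, 0) := by
    have hGc := G.continuous
    refine congrFun (cov.eq_of_comp_eq (g₁ := fun t : unitInterval => G (t, (1 : ℝ)))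
      (g₂ := fun t => g • G (t, (0 : ℝ))) (by fun_prop) (Continuous.const_smul (by fun_prop) g)
      (funext fun t => ?_) 0 ?_)
    · change proj Γ _ = proj Γ _
      rw [proj_eq_iff.mpr ⟨g, hg, rfl⟩, hGlift, hGlift]
      change F (t, ((1 : ℝ) : UnitAddCircle)) = F (t, ((0 : ℝ) : UnitAddCircle))
      rw [AddCircle.coe_period, AddCircle.coe_zero]
    · rw [hG0, hG0, hgc]
      congr 1
      ring
  have hend : ∀ s, proj Γ (G (1, s)) = proj Γ (c' (L' * s)) := by
    intro s
    rw [hGlift, ← hfc']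
    exact F.apply_one _
  obtain ⟨δ, hδ, hδ0⟩ := proj_eq_iff.mp (hend 0)
  -- At time one the lifted homotopy and the translate of `c'` by `δ` lift the same path and agree
  -- at `0`.
  have hend' : ∀ s, G (1, s) = δ • c' (L' * s) := by
    have hGc := G.continuous
    have hc'c := hc'.continuous
    refine congrFun (cov.eq_of_comp_eq (g₁ := fun s : ℝ => G (1, s))
      (g₂ := fun s => δ • c' (L' * s)) (by fun_prop) (Continuous.const_smul (by fun_prop) δ)
      (funext fun s => ?_) 0 hδ0.symm)
    change proj Γ _ = proj Γ _
    rw [hend]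
    exact (proj_eq_iff.mpr ⟨δ, hδ, rfl⟩).symm
  refine ⟨δ, hδ, ?_⟩
  have h1 := hequiv 1
  rw [hend', hend', mul_one, mul_zero, show L' = 0 + L' by ring, ← hgc', ← mul_smul,
    ← mul_smul] at h1
  -- `g δ` and `δ g'` agree at the single point `c' 0`; freeness makes them equal.
  have h2 : (δ * g')⁻¹ * (g * δ) = 1 := by
    refine hfree _ (Γ.mul_mem (Γ.inv_mem (Γ.mul_mem hδ hg')) (Γ.mul_mem hg hδ)) (c' 0) ?_
    rw [mul_smul, ← h1, inv_smul_smul]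
  exact (inv_mul_eq_one.mp h2).symm

section Traces

variable {d : ℕ}

/-! ## Traces in the congruence subgroup -/

theorem exists_eq_add_mul_of_mk_eq {u x y : Od d}
    (h : Ideal.Quotient.mk (Ideal.span {u}) x = Ideal.Quotient.mk (Ideal.span {u}) y) :
    ∃ z, x = y + u * z := by
  rw [Ideal.Quotient.mk_eq_mk_iff_sub_mem, Ideal.mem_span_singleton] at h
  obtain ⟨z, hz⟩ := h
  exact ⟨z, by linear_combination hz⟩

theorem red_apply (u : Od d) (g : SL(2, Od d)) (i j : Fin 2) :
    red u g i j = Ideal.Quotient.mk (Ideal.span {u}) (g i j) := rfl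

/-- With `g = μ + uX`, where `μ` is `1` or the lift of `τ`, expand `det g = 1` modulo `u²`: the term
linear in `u` is `μ u` times the trace of `X`. -/
theorem trace_dichotomy {D t u : Od d} (hD : IsDiscriminant D) (h : IsPell D t u)
    {g : SL(2, Od d)} (hg : g ∈ tauGroup u (tau hD h) (tau_sq hD h)) :
    u ^ 2 ∣ (g : Matrix (Fin 2) (Fin 2) (Od d)).trace - 2 ∨
      u ^ 2 ∣ (g : Matrix (Fin 2) (Fin 2) (Od d)).trace - t := by
  have hdet := g.det_coe
  rw [Matrix.det_fin_two] at hdet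
  rw [Matrix.trace_fin_two]
  rcases hg with hg | hg
  · left
    have hij : ∀ i j, red u g i j
        = Ideal.Quotient.mk (Ideal.span {u}) ((1 : SL(2, Od d)) i j) := by
      intro i j; rw [hg, ← red_apply, map_one]
    obtain ⟨x, hx⟩ := exists_eq_add_mul_of_mk_eq (hij 0 0)
    obtain ⟨y, hy⟩ := exists_eq_add_mul_of_mk_eq (hij 0 1)
    obtain ⟨z, hz⟩ := exists_eq_add_mul_of_mk_eq (hij 1 0)
    obtain ⟨w, hw⟩ := exists_eq_add_mul_of_mk_eq (hij 1 1)
    simp at hx hy hz hw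
    rw [hx, hy, hz, hw] at hdet
    rw [hx, hw]
    exact ⟨y * z - x * w, by linear_combination hdet⟩
  · right
    obtain ⟨ξ, hξ⟩ := hD.1.choose_spec
    have hmul := half_mul hD.1.choose_spec h hξ
    have htwo := two_mul_half hD.1.choose_spec h
    set β := hD.1.choose
    set μ := half hD.1.choose_spec h with hμ
    have h00 : red u g 0 0 = Ideal.Quotient.mk (Ideal.span {u}) μ := by rw [hg]; rfl
    have h01 : red u g 0 1 = Ideal.Quotient.mk (Ideal.span {u}) 0 := by rw [hg]; rfl
    have h10 : red u g 1 0 = Ideal.Quotient.mk (Ideal.span {u}) 0 := by rw [hg]; rfl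
    have h11 : red u g 1 1 = Ideal.Quotient.mk (Ideal.span {u}) μ := by rw [hg]; rfl
    obtain ⟨x, hx⟩ := exists_eq_add_mul_of_mk_eq h00
    obtain ⟨y, hy⟩ := exists_eq_add_mul_of_mk_eq h01
    obtain ⟨z, hz⟩ := exists_eq_add_mul_of_mk_eq h10
    obtain ⟨w, hw⟩ := exists_eq_add_mul_of_mk_eq h11
    rw [hx, hy, hz, hw] at hdet
    rw [hx, hw]
    -- Here trace minus `t` is `u (x + w - β)`. Comparing `hdet` with `hmul` shows that `μ` times it
    -- is `-u² (xw - yz + ξ)`; multiply by `μ + βu`, the inverse of `μ` modulo `u²`.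
    refine ⟨-(x * w - y * z + ξ) * (μ + β * u) - ξ * u * (x + w - β), ?_⟩
    linear_combination htwo + (μ + β * u) * hdet - (μ + β * u) * hmul
      - (u * (x + w - β)) * hmul

/-! ## Estimates -/

/-- With `x = |u|² ≥ 1`, the Pell equation gives `51x ≤ |t|² + 4 ≤ (16/81) x² + 4`, which fails on
`[1, 250]`. The first inequality also yields `|t|² ≥ 47`. -/
theorem norm_sq_pell_large {D t u : Od d} (hlarge : 51 < ‖emb d D‖) (h : IsPell D t u)
    (hm : ‖emb d t‖ < 4 / 9 * ‖emb d u‖ ^ 2) :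
    250 ≤ ‖emb d u‖ ^ 2 ∧ 2 < ‖emb d t‖ := by
  have hu0 : u ≠ 0 := by
    rintro rfl
    simp at hm
    linarith [norm_nonneg (emb d t)]
  have hu1 := one_le_norm_emb hu0
  have hC : emb d D * emb d u ^ 2 = emb d t ^ 2 - 4 := by
    have := congrArg (emb d) (show t ^ 2 - D * u ^ 2 = 4 from h)
    simp only [map_sub, map_mul, map_pow, map_ofNat] at this
    linear_combination -this
  have h1 : ‖emb d D‖ * ‖emb d u‖ ^ 2 ≤ ‖emb d t‖ ^ 2 + 4 := by
    have := norm_sub_le (emb d t ^ 2) 4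
    rw [← hC] at this
    simpa using this
  set x := ‖emb d u‖ ^ 2 with hx
  have hx1 : 1 ≤ x := by nlinarith
  have h2 : 51 * x ≤ ‖emb d t‖ ^ 2 + 4 := by nlinarith
  have h3 : ‖emb d t‖ ^ 2 ≤ (4 / 9 * x) ^ 2 := by
    have := norm_nonneg (emb d t)
    gcongr
  constructor
  · by_contra hlt
    nlinarith [mul_nonneg (sub_nonneg.mpr hx1) (sub_nonneg.mpr (not_le.mp hlt).le)]
  · by_contra hlt
    nlinarith [norm_nonneg (emb d t)]

theorem le_norm_of_dvd_sub {u x y : Od d} (h : u ^ 2 ∣ x - y) (hne : x ≠ y) :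
    ‖emb d u‖ ^ 2 - ‖emb d y‖ ≤ ‖emb d x‖ := by
  obtain ⟨z, hz⟩ := h
  have hz0 : z ≠ 0 := by
    rintro rfl
    rw [mul_zero, sub_eq_zero] at hz
    exact hne hz
  have h1 := one_le_norm_emb hz0
  have h2 : ‖emb d u‖ ^ 2 * ‖emb d z‖ = ‖emb d x - emb d y‖ := by
    rw [← map_sub, hz, map_mul, map_pow, norm_mul, norm_pow]
  have h3 := norm_sub_le (emb d x) (emb d y)
  nlinarith [sq_nonneg ‖emb d u‖]

theorem trace_estimate {D t u : Od d} (hD : IsDiscriminant D) (hlarge : 51 < ‖emb d D‖)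
    (h : IsPell D t u) (hm : ‖emb d t‖ < 4 / 9 * ‖emb d u‖ ^ 2)
    {g : SL(2, Od d)} (hg : g ∈ tauGroup u (tau hD h) (tau_sq hD h)) {τ : Od d}
    (hτ : (g : Matrix (Fin 2) (Fin 2) (Od d)).trace = τ) (hτ2 : τ ≠ 2) :
    2 < ‖emb d τ‖ ∧
      ‖emb d t‖ ^ 2 + ‖emb d t ^ 2 - 4‖ ≤ ‖emb d τ‖ ^ 2 + ‖emb d τ ^ 2 - 4‖ := by
  obtain ⟨hx, ht2⟩ := norm_sq_pell_large hlarge h hm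
  by_cases hτt : τ = t
  · rw [hτt]; exact ⟨ht2, le_rfl⟩
  -- `5/9 = 1 - 4/9`; when the trace is congruent to `2`, the bound on `|u|²` absorbs the `2`. In
  -- the end `25/81` beats `16/81` as the coefficient of `|u|⁴`.
  have h59 : 5 / 9 * ‖emb d u‖ ^ 2 ≤ ‖emb d τ‖ := by
    rcases trace_dichotomy hD h hg with h1 | h1
    · rw [hτ] at h1
      have := le_norm_of_dvd_sub h1 hτ2
      rw [map_ofNat, Complex.norm_ofNat] at this
      linarith
    · rw [hτ] at h1
      have := le_norm_of_dvd_sub h1 hτt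
      linarith
  refine ⟨by linarith, ?_⟩
  have e1 : ‖emb d t ^ 2 - 4‖ ≤ ‖emb d t‖ ^ 2 + 4 := by
    have := norm_sub_le (emb d t ^ 2) 4
    rwa [norm_pow, Complex.norm_ofNat] at this
  have e2 : ‖emb d τ‖ ^ 2 - 4 ≤ ‖emb d τ ^ 2 - 4‖ := by
    have := norm_sub_norm_le (emb d τ ^ 2) 4
    rwa [norm_pow, Complex.norm_ofNat] at this
  have e3 : ‖emb d t‖ ^ 2 ≤ (4 / 9 * ‖emb d u‖ ^ 2) ^ 2 := by
    have := norm_nonneg (emb d t)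
    gcongr
  have e4 : (5 / 9 * ‖emb d u‖ ^ 2) ^ 2 ≤ ‖emb d τ‖ ^ 2 := by gcongr
  nlinarith

end Traces

/-! ## Elements of finite order -/

theorem norm_trace_le_two_of_pow_eq_one {g : SL(2, ℂ)} {n : ℕ} (hn : 0 < n) (h : g ^ n = 1) :
    ‖(g : Matrix (Fin 2) (Fin 2) ℂ).trace‖ ≤ 2 := by
  set τ := (g : Matrix (Fin 2) (Fin 2) ℂ).trace with hτ
  have hdet := g.det_coe
  rw [Matrix.det_fin_two] at hdet
  rw [Matrix.trace_fin_two] at hτ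
  obtain ⟨s, hs⟩ := IsAlgClosed.exists_eq_mul_self (τ ^ 2 - 4)
  obtain ⟨μ, hμ⟩ : ∃ μ, μ = (τ + s) / 2 := ⟨_, rfl⟩
  obtain ⟨ν, hν⟩ : ∃ ν, ν = (τ - s) / 2 := ⟨_, rfl⟩
  have hμν : μ * ν = 1 := by rw [hμ, hν]; linear_combination hs / 4
  have hsum : τ = μ + ν := by rw [hμ, hν]; ring
  have hdet0 : (g.1 - algebraMap ℂ _ μ).det = 0 := by
    rw [Matrix.det_fin_two]
    simp only [Matrix.sub_apply, Matrix.algebraMap_matrix_apply]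
    simp
    linear_combination hdet - μ * hτ.symm - μ * hsum - hμν
  -- The singular matrix `g - μ` divides `gⁿ - μⁿ = (1 - μⁿ) Id`, so the eigenvalue `μ` is a root of
  -- unity.
  have hgeom := (Algebra.commute_algebraMap_right μ g.1).mul_geom_sum₂ n
  have hgn : g.1 ^ n = 1 := by
    rw [← Matrix.SpecialLinearGroup.coe_pow, h, Matrix.SpecialLinearGroup.coe_one]
  have hμn : μ ^ n = 1 := by
    have := congrArg Matrix.det hgeom
    rw [Matrix.det_mul, hdet0, zero_mul, hgn, ← map_pow, ← map_one (algebraMap ℂ _), ← map_sub,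
      Matrix.algebraMap_eq_diagonal, Matrix.det_diagonal] at this
    have h2 : (1 - μ ^ n) ^ 2 = 0 := by
      rw [this]; simp [sq]
    linear_combination -(pow_eq_zero_iff two_ne_zero).mp h2
  have h1 : ‖μ‖ = 1 := Complex.norm_eq_one_of_pow_eq_one hμn hn.ne'
  have h2 : ‖ν‖ = 1 := by
    have := congrArg norm hμν
    rwa [norm_mul, h1, one_mul, norm_one] at this
  rw [hsum]
  refine (norm_add_le _ _).trans ?_
  rw [h1, h2]
  norm_num

theorem eq_one_of_pow_eq_one {g : SL(2, ℂ)} {n : ℕ} (hn : 0 < n) (h : g ^ n = 1)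
    (htr : (g : Matrix (Fin 2) (Fin 2) ℂ).trace = 2) : g = 1 := by
  have hdet := g.det_coe
  rw [Matrix.det_fin_two] at hdet
  rw [Matrix.trace_fin_two] at htr
  -- A unipotent matrix satisfies `gᵏ = k g - (k - 1)`, so finite order forces `g = 1`.
  have hpow : ∀ (k : ℕ) (i j : Fin 2), (g ^ k) i j = k * g i j - (k - 1) * (1 : SL(2, ℂ)) i j := by
    intro k
    induction k with
    | zero => intro i j; simp
    | succ k ih =>
      intro i j
      rw [pow_succ, H3.mul_entry, ih, ih]
      push_cast
      fin_cases i <;> fin_cases j <;> simp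
      · linear_combination (k * g 0 0) * htr - k * hdet
      · linear_combination (k * g 0 1) * htr
      · linear_combination (k * g 1 0) * htr
      · linear_combination (k * g 1 1) * htr - k * hdet
  have hn' : (n : ℂ) ≠ 0 := Nat.cast_ne_zero.mpr hn.ne'
  refine Subtype.ext (Matrix.ext fun i j => ?_)
  have := hpow n i j
  rw [h] at this
  apply mul_left_cancel₀ hn'
  linear_combination -this

variable {d : ℕ}

/-! ## Units attached to the Pell equation -/

theorem emb_pell {D t u : Od d} (h : IsPell D t u) :
    emb d t ^ 2 - emb d D * emb d u ^ 2 = 4 := by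
  have := congrArg (emb d) (show t ^ 2 - D * u ^ 2 = 4 from h)
  simpa only [map_sub, map_mul, map_pow, map_ofNat] using this

theorem eps_inv {D t u : Od d} (h : IsPell D t u) :
    (eps D t u)⁻¹ = (emb d t - emb d u * sqrtUp (emb d D)) / 2 := by
  apply inv_eq_of_mul_eq_one_right
  have hC := emb_pell h
  have hs := sqrtUp_sq (emb d D)
  unfold eps
  linear_combination hC / 4 - emb d u ^ 2 / 4 * hs

theorem emb_t_eq {D t u : Od d} (h : IsPell D t u) :
    emb d t = eps D t u + (eps D t u)⁻¹ := by
  rw [eps_inv h, eps]; ring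

theorem emb_u_mul_sqrt_eq {D t u : Od d} (h : IsPell D t u) :
    emb d u * sqrtUp (emb d D) = eps D t u - (eps D t u)⁻¹ := by
  rw [eps_inv h, eps]; ring

theorem norm_trace_add {μ τ : ℂ} (hμ : μ ≠ 0) (hτ : τ = μ + μ⁻¹) :
    ‖τ‖ ^ 2 + ‖τ ^ 2 - 4‖ = 2 * (‖μ‖ ^ 2 + (‖μ‖ ^ 2)⁻¹) := by
  have e : τ ^ 2 - 4 = (μ - μ⁻¹) ^ 2 := by
    rw [hτ]; field_simp; ring
  have := parallelogram_law_with_norm ℝ μ μ⁻¹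
  rw [e, hτ, norm_pow, ← inv_pow, ← norm_inv]
  linarith

theorem ne_zero_of_one_lt_norm {μ : ℂ} (h : 1 < ‖μ‖) : μ ≠ 0 := by
  rintro rfl
  rw [norm_zero] at h
  linarith

/-- The lower bound of `H3.le_cosh_hdist_smul` is thus exactly the `cosh` of the translation length
found in `H3.exists_axis`. -/
theorem four_cosh_two_mul_log {μ τ : ℂ} (hμ : 1 < ‖μ‖) (hτ : τ = μ + μ⁻¹) :
    (‖τ‖ ^ 2 + ‖τ ^ 2 - 4‖) / 4 = Real.cosh (2 * Real.log ‖μ‖) := by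
  rw [norm_trace_add (ne_zero_of_one_lt_norm hμ) hτ, Real.cosh_eq, Real.exp_neg,
    mul_comm 2 (Real.log _), Real.exp_mul, Real.exp_log (by linarith), Real.rpow_two]
  ring

theorem isLoxodromic_of_trace {g : SL(2, ℂ)} {μ : ℂ} (hμ : 1 < ‖μ‖)
    (hτ : (g : Matrix (Fin 2) (Fin 2) ℂ).trace = μ + μ⁻¹) : IsLoxodromic g := by
  rintro ⟨x, hx, htr⟩
  have h1 := norm_trace_add (ne_zero_of_one_lt_norm hμ) hτ
  rw [htr] at h1
  have hx2 : x ^ 2 ≤ 4 := by nlinarith [sq_abs x, abs_nonneg x]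
  have e : (x : ℂ) ^ 2 - 4 = ((x ^ 2 - 4 : ℝ) : ℂ) := by push_cast; rfl
  rw [e, Complex.norm_real, Complex.norm_real, Real.norm_eq_abs, Real.norm_eq_abs, sq_abs,
    abs_of_nonpos (by linarith)] at h1
  have hy : 1 < ‖μ‖ ^ 2 := by nlinarith
  have h2 : ‖μ‖ ^ 2 * (‖μ‖ ^ 2)⁻¹ = 1 := mul_inv_cancel₀ (by positivity)
  nlinarith [mul_pos (sub_pos.mpr hy) (sub_pos.mpr hy)]

theorem u_ne_zero {D t u : Od d} (h : IsPell D t u) (hε : 1 < ‖eps D t u‖) : u ≠ 0 := by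
  rintro rfl
  have h1 := emb_u_mul_sqrt_eq h
  rw [map_zero, zero_mul, eq_comm, sub_eq_zero] at h1
  have h2 := congrArg norm h1
  rw [norm_inv] at h2
  have := inv_lt_one_of_one_lt₀ hε
  linarith

theorem one_lt_norm_eps_seq {D t₀ u₀ : Od d} (h : IsFundamentalSolution D t₀ u₀) (n : ℕ) :
    1 < ‖eps D (pellT t₀ n) (pellU t₀ u₀ n)‖ := by
  rw [eps_pow h.1, norm_pow]
  exact one_lt_pow₀ h.2.1 n.succ_ne_zero

/-- The index `m(ε)` is well defined. -/
theorem pellIndex_spec {D t₀ u₀ : Od d} (hD : D ≠ 0) (h : IsFundamentalSolution D t₀ u₀) :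
    ‖emb d (pellT t₀ (pellIndex t₀ u₀))‖
      < 4 / 9 * ‖emb d (pellU t₀ u₀ (pellIndex t₀ u₀))‖ ^ 2 := by
  refine Nat.sInf_mem
    (s := {n : ℕ | ‖emb d (pellT t₀ n)‖ < 4 / 9 * ‖emb d (pellU t₀ u₀ n)‖ ^ 2}) ?_
  -- With `y = |ε| - 1` for the `n`-th unit `ε`, one has `|u|² |D| ≥ y²`. Once `y ≥ 9 + 9|D|` this
  -- gives `|u|² ≥ 9y`, and `4y > y + 2 ≥ |t|`.
  obtain ⟨n, hn⟩ := pow_unbounded_of_one_lt (10 + 9 * ‖emb d D‖) h.2.1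
  refine ⟨n, ?_⟩
  have hP := isPell_seq h.1 n
  have hE1 := one_lt_norm_eps_seq h n
  have hE : 10 + 9 * ‖emb d D‖ < ‖eps D (pellT t₀ n) (pellU t₀ u₀ n)‖ := by
    rw [eps_pow h.1, norm_pow, pow_succ]
    have h0 : 0 ≤ ‖eps D t₀ u₀‖ ^ n := by positivity
    nlinarith [h.2.1]
  have ht := emb_t_eq hP
  have hu := emb_u_mul_sqrt_eq hP
  set E := eps D (pellT t₀ n) (pellU t₀ u₀ n)
  have hinv : ‖E⁻¹‖ < 1 := by rw [norm_inv]; exact inv_lt_one_of_one_lt₀ hE1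
  have h1 : ‖emb d (pellT t₀ n)‖ ≤ ‖E‖ + 1 := by
    rw [ht]; linarith [norm_add_le E E⁻¹]
  have h2 : ‖E‖ - 1 ≤ ‖emb d (pellU t₀ u₀ n)‖ * ‖sqrtUp (emb d D)‖ := by
    rw [← norm_mul, hu]; linarith [norm_sub_norm_le E E⁻¹]
  have hs : ‖sqrtUp (emb d D)‖ ^ 2 = ‖emb d D‖ := by rw [← norm_pow, sqrtUp_sq]
  have hD1 : 1 ≤ ‖emb d D‖ := one_le_norm_emb hD
  have h3 : (‖E‖ - 1) ^ 2 ≤ ‖emb d (pellU t₀ u₀ n)‖ ^ 2 * ‖emb d D‖ := by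
    rw [← hs, ← mul_pow]
    have : 0 ≤ ‖E‖ - 1 := by linarith
    gcongr
  set y := ‖E‖ - 1 with hy
  have h4 : 9 * ‖emb d D‖ * y ≤ ‖emb d D‖ * ‖emb d (pellU t₀ u₀ n)‖ ^ 2 := by nlinarith
  have h5 : 9 * y ≤ ‖emb d (pellU t₀ u₀ n)‖ ^ 2 := by
    refine le_of_mul_le_mul_left ?_ (show 0 < ‖emb d D‖ by linarith)
    linarith
  change ‖emb d (pellT t₀ n)‖ < 4 / 9 * ‖emb d (pellU t₀ u₀ n)‖ ^ 2
  linarith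

/-! ## Automorphs -/

theorem two_ne_zero_Od : (2 : Od d) ≠ 0 := OfNat.ofNat_ne_zero 2

theorem sl_mul_apply {R : Type*} [CommRing R] (g h : SL(2, R)) (i j : Fin 2) :
    (g * h) i j = g i 0 * h 0 j + g i 1 * h 1 j := by
  simp [Matrix.mul_apply, Fin.sum_univ_two]

section Automorph

variable (Q : BinForm (Od d)) {t u : Od d} (h : IsPell Q.disc t u)

theorem automorph_00 : 2 * automorph Q h 0 0 = t - Q.b * u := two_mul_half Q.four_dvd h

theorem automorph_01 : automorph Q h 0 1 = -(Q.c * u) := rfl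

theorem automorph_10 : automorph Q h 1 0 = Q.a * u := rfl

theorem automorph_11 : 2 * automorph Q h 1 1 = t + Q.b * u := by
  have := two_mul_half Q.four_dvd h
  change 2 * (half Q.four_dvd h + Q.b * u) = _
  linear_combination this

theorem eq_automorph {g : SL(2, Od d)} (h00 : 2 * g 0 0 = t - Q.b * u) (h01 : g 0 1 = -(Q.c * u))
    (h10 : g 1 0 = Q.a * u) (h11 : 2 * g 1 1 = t + Q.b * u) : g = automorph Q h := by
  refine Subtype.ext (Matrix.ext fun i j => ?_)
  fin_cases i <;> fin_cases j
  · exact mul_left_cancel₀ two_ne_zero_Od (h00.trans (automorph_00 Q h).symm)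
  · exact h01
  · exact h10
  · exact mul_left_cancel₀ two_ne_zero_Od (h11.trans (automorph_11 Q h).symm)

theorem automorph_trace : (automorph Q h : Matrix (Fin 2) (Fin 2) (Od d)).trace = t := by
  rw [Matrix.trace_fin_two]
  apply mul_left_cancel₀ (two_ne_zero_Od (d := d))
  linear_combination automorph_00 Q h + automorph_11 Q h

theorem subst_automorph : Q.subst (automorph Q h) = Q := by
  have hm := half_mul Q.four_dvd h (ξ := -(Q.a * Q.c)) (by simp only [BinForm.disc]; ring)
  have e00 : automorph Q h 0 0 = half Q.four_dvd h := rfl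
  have e11 : automorph Q h 1 1 = half Q.four_dvd h + Q.b * u := rfl
  refine BinForm.ext ?_ ?_ ?_
  · simp only [BinForm.subst, BinForm.eval, e00, automorph_10]
    linear_combination Q.a * hm
  · simp only [BinForm.subst, e00, e11, automorph_01, automorph_10]
    linear_combination Q.b * hm
  · simp only [BinForm.subst, BinForm.eval, e11, automorph_01]
    linear_combination Q.c * hm

theorem automorph_pow_succ (n : ℕ) :
    automorph Q h ^ (n + 1) = automorph Q (isPell_seq h n) := by
  have hdet := (automorph Q h).det_coe
  rw [Matrix.det_fin_two] at hdet
  have h00 := automorph_00 Q h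
  have h01 := automorph_01 Q h
  have h10 := automorph_10 Q h
  have h11 := automorph_11 Q h
  set A := automorph Q h
  have htr : A 0 0 + A 1 1 = t := by
    apply mul_left_cancel₀ (two_ne_zero_Od (d := d))
    linear_combination h00 + h11
  have hrec : ∀ (n : ℕ) (i j : Fin 2), (A ^ (n + 2)) i j = t * (A ^ (n + 1)) i j - (A ^ n) i j := by
    intro n i j
    rw [pow_succ' A (n + 1), sl_mul_apply, pow_succ' A n, sl_mul_apply, sl_mul_apply, sl_mul_apply]
    fin_cases i <;> simp only [Fin.zero_eta, Fin.mk_one]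
    · linear_combination (A 0 0 * (A ^ n) 0 j + A 0 1 * (A ^ n) 1 j) * htr - (A ^ n) 0 j * hdet
    · linear_combination (A 1 0 * (A ^ n) 0 j + A 1 1 * (A ^ n) 1 j) * htr - (A ^ n) 1 j * hdet
  -- Cayley–Hamilton gives the powers the recurrence of `lucas`. Two consecutive powers are carried
  -- along; the zeroth, the identity, matches the solution `(2, 0)`.
  have hmain : ∀ n : ℕ, (2 * (A ^ (n + 1)) 0 0 = (lucas t t 2 n).1 - Q.b * (lucas t u 0 n).1 ∧
      (A ^ (n + 1)) 0 1 = -(Q.c * (lucas t u 0 n).1) ∧ (A ^ (n + 1)) 1 0 = Q.a * (lucas t u 0 n).1 ∧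
      2 * (A ^ (n + 1)) 1 1 = (lucas t t 2 n).1 + Q.b * (lucas t u 0 n).1) ∧
      (2 * (A ^ n) 0 0 = (lucas t t 2 n).2 - Q.b * (lucas t u 0 n).2 ∧
      (A ^ n) 0 1 = -(Q.c * (lucas t u 0 n).2) ∧ (A ^ n) 1 0 = Q.a * (lucas t u 0 n).2 ∧
      2 * (A ^ n) 1 1 = (lucas t t 2 n).2 + Q.b * (lucas t u 0 n).2) := by
    intro n
    induction n with
    | zero =>
      simp only [zero_add, pow_one, pow_zero, lucas]
      exact ⟨⟨h00, h01, h10, h11⟩, by simp, by simp, by simp, by simp⟩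
    | succ n ih =>
      obtain ⟨⟨a1, a2, a3, a4⟩, b1, b2, b3, b4⟩ := ih
      refine ⟨?_, a1, a2, a3, a4⟩
      simp only [hrec n, lucas]
      refine ⟨?_, ?_, ?_, ?_⟩
      · linear_combination t * a1 - b1
      · linear_combination t * a2 - b2
      · linear_combination t * a3 - b3
      · linear_combination t * a4 - b4
  obtain ⟨a1, a2, a3, a4⟩ := (hmain n).1
  exact eq_automorph Q _ a1 a2 a3 a4

/-- The coefficient `b` is itself an admissible `β`, and all other terms are multiples of `u`. -/
theorem automorph_mem_tauGroup (hD : IsDiscriminant Q.disc) :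
    automorph Q h ∈ tauGroup u (tau hD h) (tau_sq hD h) := by
  right
  have hτ := tau_eq hD h Q.four_dvd (two_mul_half Q.four_dvd h)
  have hu : Ideal.Quotient.mk (Ideal.span {u}) u = 0 :=
    Ideal.Quotient.eq_zero_iff_mem.mpr (Ideal.mem_span_singleton_self u)
  refine Subtype.ext (Matrix.ext fun i j => ?_)
  change red u (automorph Q h) i j = _
  rw [red_apply]
  fin_cases i <;> fin_cases j
  · exact hτ.symm
  · change Ideal.Quotient.mk (Ideal.span {u}) (-(Q.c * u)) = 0
    rw [map_neg, map_mul, hu, mul_zero, neg_zero]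
  · change Ideal.Quotient.mk (Ideal.span {u}) (Q.a * u) = 0
    rw [map_mul, hu, mul_zero]
  · change Ideal.Quotient.mk (Ideal.span {u}) (half Q.four_dvd h + Q.b * u) = tau hD h
    rw [map_add, map_mul, hu, mul_zero, add_zero, hτ]

/-! ### Centralizers and conjugacy of automorphs. -/

theorem exists_bezout {R : Type*} [CommRing R] {Q : BinForm R} (hQ : Q.IsPrimitive) :
    ∃ x y z : R, x * Q.a + y * Q.b + z * Q.c = 1 := by
  have : (1 : R) ∈ Ideal.span {Q.a, Q.b, Q.c} := by
    rw [show Ideal.span {Q.a, Q.b, Q.c} = ⊤ from hQ]; trivial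
  obtain ⟨x, w, hw, h1⟩ := Ideal.mem_span_insert.mp this
  obtain ⟨y, z, rfl⟩ := Ideal.mem_span_pair.mp hw
  exact ⟨x, y, z, by linear_combination -h1⟩

/-- An automorph of a primitive form determines the solution of the Pell equation. -/
theorem automorph_eq_iff {Q : BinForm (Od d)} (hQ : Q.IsPrimitive) {t u t' u' : Od d}
    {h : IsPell Q.disc t u} {h' : IsPell Q.disc t' u'} (e : automorph Q h = automorph Q h') :
    t = t' ∧ u = u' := by
  constructor
  · rw [← automorph_trace Q h, e, automorph_trace]
  · obtain ⟨x, y, z, hxyz⟩ := exists_bezout hQ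
    have e1 := automorph_10 Q h
    have e2 := automorph_01 Q h
    have e3 := automorph_11 Q h
    have e4 := automorph_00 Q h
    rw [e] at e1 e2 e3 e4
    rw [automorph_10] at e1
    rw [automorph_01] at e2
    rw [automorph_11] at e3
    rw [automorph_00] at e4
    have e5 : Q.b * u' = Q.b * u := by
      apply mul_left_cancel₀ (two_ne_zero_Od (d := d))
      linear_combination e3 - e4
    linear_combination (u' - u) * hxyz - x * e1 - y * e5 + z * e2

/-- A matrix commuting with the automorphs of a primitive form is an automorph. -/
theorem exists_eq_automorph_of_commute {Q : BinForm (Od d)} (hQ : Q.IsPrimitive) {t u : Od d}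
    (hu : u ≠ 0) {h : IsPell Q.disc t u} {A : SL(2, Od d)}
    (hA : A * automorph Q h = automorph Q h * A) :
    ∃ (t' u' : Od d) (h' : IsPell Q.disc t' u'), A = automorph Q h' := by
  have hdet := A.det_coe
  rw [Matrix.det_fin_two] at hdet
  obtain ⟨x, y, z, hxyz⟩ := exists_bezout hQ
  have e : ∀ i j, (A * automorph Q h) i j = (automorph Q h * A) i j := fun i j => by rw [hA]
  have d1 := automorph_00 Q h
  have d2 := automorph_11 Q h
  have e00 := e 0 0
  have e01 := e 0 1
  have e10 := e 1 0
  simp only [sl_mul_apply, automorph_01, automorph_10] at e00 e01 e10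
  have hd : automorph Q h 1 1 - automorph Q h 0 0 = Q.b * u := by
    apply mul_left_cancel₀ (two_ne_zero_Od (d := d))
    linear_combination d2 - d1
  have k1 : A 0 1 * Q.a = -(Q.c * A 1 0) := by
    apply mul_right_cancel₀ hu
    linear_combination e00
  have k2 : A 0 1 * Q.b = -Q.c * (A 1 1 - A 0 0) := by
    apply mul_right_cancel₀ hu
    linear_combination e01 - A 0 1 * hd
  have k3 : A 1 0 * Q.b = Q.a * (A 1 1 - A 0 0) := by
    apply mul_right_cancel₀ hu
    linear_combination -e10 - A 1 0 * hd
  -- Commuting makes `(A 1 0, A 1 1 - A 0 0, -A 0 1)` proportional to `(a, b, c)`. The Bézout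
  -- relation produces the factor `w` inside `𝒪_d`, without division.
  obtain ⟨w, hw⟩ : ∃ w, w = x * A 1 0 + y * (A 1 1 - A 0 0) - z * A 0 1 := ⟨_, rfl⟩
  have w10 : A 1 0 = Q.a * w := by
    rw [hw]; linear_combination (-A 1 0) * hxyz + y * k3 + z * k1
  have w01 : A 0 1 = -(Q.c * w) := by
    rw [hw]; linear_combination (-A 0 1) * hxyz + x * k1 + y * k2
  have wb : A 1 1 - A 0 0 = Q.b * w := by
    rw [hw]; linear_combination (-(A 1 1 - A 0 0)) * hxyz - x * k3 + z * k2
  refine ⟨A 0 0 + A 1 1, w, ?_, eq_automorph Q _ ?_ w01 w10 ?_⟩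
  · unfold IsPell BinForm.disc
    rw [w01, w10] at hdet
    linear_combination 4 * hdet + (A 1 1 - A 0 0 + Q.b * w) * wb
  · linear_combination -wb
  · linear_combination wb

theorem disc_subst {R : Type*} [CommRing R] (Q : BinForm R) (g : SL(2, R)) :
    (Q.subst g).disc = Q.disc := by
  have hdet := g.det_coe
  rw [Matrix.det_fin_two] at hdet
  simp only [BinForm.disc, BinForm.subst, BinForm.eval]
  linear_combination (Q.b ^ 2 - 4 * Q.a * Q.c) * (g 0 0 * g 1 1 - g 0 1 * g 1 0 + 1) * hdet

/-- Naturality: substitution in the form corresponds to conjugation of the automorph, for the same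
Pell solution. -/
theorem automorph_mul_eq (g : SL(2, Od d)) (h' : IsPell (Q.subst g).disc t u) :
    automorph Q h * g = g * automorph (Q.subst g) h' := by
  have hdet := g.det_coe
  rw [Matrix.det_fin_two] at hdet
  have a00 := automorph_00 Q h
  have a11 := automorph_11 Q h
  have b00 := automorph_00 (Q.subst g) h'
  have b11 := automorph_11 (Q.subst g) h'
  refine Subtype.ext (Matrix.ext fun i j => mul_left_cancel₀ (two_ne_zero_Od (d := d)) ?_)
  change 2 * (automorph Q h * g) i j = 2 * (g * automorph (Q.subst g) h') i j
  rw [sl_mul_apply, sl_mul_apply]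
  fin_cases i <;> fin_cases j <;>
    simp only [Fin.zero_eta, Fin.mk_one, automorph_01, automorph_10]
  · simp only [BinForm.subst, BinForm.eval] at b00 b11 ⊢
    linear_combination g 0 0 * a00 - g 0 0 * b00 + u * (Q.b * g 0 0 + 2 * Q.c * g 1 0) * hdet
  · simp only [BinForm.subst, BinForm.eval] at b00 b11 ⊢
    linear_combination g 0 1 * a00 - g 0 1 * b11 + u * (Q.b * g 0 1 + 2 * Q.c * g 1 1) * hdet
  · simp only [BinForm.subst, BinForm.eval] at b00 b11 ⊢
    linear_combination g 1 0 * a11 - g 1 0 * b00 - u * (Q.b * g 1 0 + 2 * Q.a * g 0 0) * hdet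
  · simp only [BinForm.subst, BinForm.eval] at b00 b11 ⊢
    linear_combination g 1 1 * a11 - g 1 1 * b11 - u * (Q.b * g 1 1 + 2 * Q.a * g 0 1) * hdet

/-- Forms with conjugate automorphs are equivalent. -/
theorem equivalent_of_automorph_mul_eq {Q Q' : BinForm (Od d)} {t u : Od d} (hu : u ≠ 0)
    (h : IsPell Q.disc t u) (h' : IsPell Q'.disc t u) {g : SL(2, Od d)}
    (hg : automorph Q h * g = g * automorph Q' h') : Q.Equivalent Q' := by
  have h'' : IsPell (Q.subst g).disc t u := by rwa [disc_subst]
  rw [automorph_mul_eq Q h g h'', mul_right_inj] at hg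
  refine ⟨g, ?_⟩
  have e : ∀ i j, automorph (Q.subst g) h'' i j = automorph Q' h' i j := fun i j => by rw [hg]
  have e10 := e 1 0
  have e01 := e 0 1
  have e00 := automorph_00 (Q.subst g) h''
  rw [e 0 0, automorph_00] at e00
  rw [automorph_10, automorph_10] at e10
  rw [automorph_01, automorph_01] at e01
  refine BinForm.ext ?_ ?_ ?_
  · exact mul_right_cancel₀ hu e10
  · exact mul_right_cancel₀ hu (by linear_combination e00)
  · exact mul_right_cancel₀ hu (by linear_combination -e01)

theorem equivalent_of_isConj_automorph {Q Q' : BinForm (Od d)} {t u : Od d} (hu : u ≠ 0)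
    (h : IsPell Q.disc t u) (h' : IsPell Q'.disc t u)
    (hc : IsConj (automorph Q h) (automorph Q' h')) : Q.Equivalent Q' := by
  obtain ⟨g, hg⟩ := isConj_iff.mp hc
  refine equivalent_of_automorph_mul_eq hu h h' (g := g⁻¹) ?_
  rw [← hg]
  group

/-- This makes the lower left entry of the automorph nonzero, as `H3.exists_axis` requires. -/
theorem a_ne_zero {Q : BinForm (Od d)} (hD : IsDiscriminant Q.disc) : Q.a ≠ 0 := by
  intro ha
  exact hD.2 ⟨Q.b, by simp only [BinForm.disc, ha]; ring⟩

theorem isLoxodromic_automorph (hε : 1 < ‖eps Q.disc t u‖) :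
    IsLoxodromic (embSL d (automorph Q h)) :=
  isLoxodromic_of_trace hε (by rw [embSL_trace, automorph_trace, emb_t_eq h])

/-- A root commutes with its power, so it is the automorph of some `(t', u')` with `ε_{t,u} =
ε_{t',u'} ^ n`. Minimality of the fundamental solution forces `n = 1`. -/
theorem isPrimitiveLoxodromic_automorph {Q : BinForm (Od d)} (hQ : Q.IsPrimitive) {t u : Od d}
    (hf : IsFundamentalSolution Q.disc t u) (h : IsPell Q.disc t u) :
    IsPrimitiveLoxodromic (automorph Q h) := by
  refine ⟨isLoxodromic_automorph Q h hf.2.1, fun A n hn hA => ?_⟩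
  have hcomm : A * automorph Q h = automorph Q h * A := by
    rw [hA, ← pow_succ, ← pow_succ']
  obtain ⟨t', u', h', rfl⟩ := exists_eq_automorph_of_commute hQ (u_ne_zero h hf.2.1) hcomm
  obtain ⟨k, rfl⟩ := Nat.exists_eq_succ_of_ne_zero hn.ne'
  have hA' := hA
  rw [Nat.succ_eq_add_one, automorph_pow_succ] at hA'
  obtain ⟨e1, e2⟩ := automorph_eq_iff hQ hA'
  have he : eps Q.disc t u = eps Q.disc t' u' ^ (k + 1) := by
    rw [← eps_pow h', ← e1, ← e2]
  have h1 : 1 < ‖eps Q.disc t' u'‖ := by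
    by_contra hle
    have := hf.2.1
    rw [he, norm_pow] at this
    exact absurd (pow_le_one₀ (norm_nonneg _) (not_lt.mp hle)) (not_le.mpr this)
  have h2 := hf.2.2 t' u' h' h1
  rw [he, norm_pow] at h2
  have hk : k + 1 ≤ 1 := (pow_le_pow_iff_right₀ h1).mp (by rwa [pow_one])
  have hk0 : k = 0 := by omega
  subst hk0
  exact ⟨rfl, by rw [hA, Nat.succ_eq_add_one, zero_add, pow_one]⟩

end Automorph

/-! ## The manifold attached to a discriminant -/

section Gamma

variable {D t₀ u₀ : Od d} (hD : IsDiscriminant D) (h₀ : IsFundamentalSolution D t₀ u₀)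

/-- The length of the closed geodesics attached to the forms of discriminant `D`. -/
def pellLength (D t₀ u₀ : Od d) : ℝ :=
  2 * Real.log ‖eps D (pellT t₀ (pellIndex t₀ u₀)) (pellU t₀ u₀ (pellIndex t₀ u₀))‖

theorem pellLength_pos {D t₀ u₀ : Od d} (h₀ : IsFundamentalSolution D t₀ u₀) :
    0 < pellLength D t₀ u₀ :=
  mul_pos two_pos (Real.log_pos (one_lt_norm_eps_seq h₀ _))

theorem IsDiscriminant.ne_zero {D : Od d} (hD : IsDiscriminant D) : D ≠ 0 := by
  rintro rfl
  exact hD.2 ⟨0, by simp⟩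

theorem trace_bounds (hlarge : 51 < ‖emb d D‖) {g : SL(2, ℂ)}
    (hg : g ∈ (gammaD hD h₀).map (embSL d))
    (h2 : (g : Matrix (Fin 2) (Fin 2) ℂ).trace ≠ 2) :
    2 < ‖(g : Matrix (Fin 2) (Fin 2) ℂ).trace‖ ∧ Real.cosh (pellLength D t₀ u₀) ≤
      (‖(g : Matrix (Fin 2) (Fin 2) ℂ).trace‖ ^ 2
        + ‖(g : Matrix (Fin 2) (Fin 2) ℂ).trace ^ 2 - 4‖) / 4 := by
  obtain ⟨g, hg, rfl⟩ := hg
  have hP := isPell_seq h₀.1 (pellIndex t₀ u₀)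
  rw [embSL_trace] at h2 ⊢
  obtain ⟨h3, h4⟩ := trace_estimate hD hlarge hP (pellIndex_spec hD.ne_zero h₀) hg rfl
    (fun e => h2 (by rw [e, map_ofNat]))
  refine ⟨h3, ?_⟩
  rw [pellLength, ← four_cosh_two_mul_log (one_lt_norm_eps_seq h₀ _) (emb_t_eq hP)]
  linarith

/-- A trace other than `2` has modulus above `2`, so the displacement is positive everywhere. -/
theorem gammaD_free (hlarge : 51 < ‖emb d D‖) {g : SL(2, ℂ)}
    (hg : g ∈ (gammaD hD h₀).map (embSL d)) (p : H3) (hp : g • p = p) : g = 1 := by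
  refine H3.eq_one_of_smul_eq hp ?_
  by_contra h2
  obtain ⟨h3, -⟩ := trace_bounds hD h₀ hlarge hg h2
  have h5 := H3.le_cosh_hdist_smul g p rfl
  rw [hp, show H3.hdist p p = 0 by simp [H3.hdist], Real.cosh_zero] at h5
  nlinarith [norm_nonneg ((g : Matrix (Fin 2) (Fin 2) ℂ).trace ^ 2 - 4)]

theorem gammaD_isDiscreteTorsionFree (hlarge : 51 < ‖emb d D‖) :
    IsDiscreteTorsionFree ((gammaD hD h₀).map (embSL d)) := by
  refine ⟨discreteTopology_map_embSL _, fun g hg hg1 n hn hgn => ?_⟩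
  by_cases h2 : (g : Matrix (Fin 2) (Fin 2) ℂ).trace = 2
  · exact hg1 (eq_one_of_pow_eq_one hn hgn h2)
  · exact absurd (norm_trace_le_two_of_pow_eq_one hn hgn)
      (not_le.mpr (trace_bounds hD h₀ hlarge hg h2).1)

theorem pellLength_le (hlarge : 51 < ‖emb d D‖) {L : ℝ}
    {f : Loop (Quot3 ((gammaD hD h₀).map (embSL d)))}
    (hf : IsClosedGeodesic ((gammaD hD h₀).map (embSL d)) L f) : pellLength D t₀ u₀ ≤ L := by
  obtain ⟨hL, c, hc, g, hg, hgc⟩ := hf.exists_translation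
  obtain ⟨-, h3⟩ := trace_bounds hD h₀ hlarge hg (H3.trace_ne_two_of_translation hc hL hgc)
  have h4 := h3.trans (H3.le_cosh_hdist_smul g (c 0) rfl)
  rw [H3.cosh_translation hc hgc, Real.cosh_le_cosh, abs_of_pos (pellLength_pos h₀),
    abs_of_pos hL] at h4
  exact h4

end Gamma

/-! ### Closed geodesics of forms, the systole and the count. -/

section Form

variable {Q : BinForm (Od d)} {t₀ u₀ : Od d} (hD : IsDiscriminant Q.disc)
  (h₀ : IsFundamentalSolution Q.disc t₀ u₀) (h : IsPell Q.disc t₀ u₀)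

theorem automorph_pow_mem : automorph Q h ^ (pellIndex t₀ u₀ + 1) ∈ gammaD hD h₀ := by
  rw [automorph_pow_succ]
  exact automorph_mem_tauGroup Q _ hD

theorem exists_closedGeodesic_pellLength :
    ∃ f, IsClosedGeodesicOf ((gammaD hD h₀).map (embSL d))
      (embSL d (automorph Q h ^ (pellIndex t₀ u₀ + 1))) (pellLength Q.disc t₀ u₀) f := by
  have hmem := Subgroup.mem_map_of_mem (embSL d) (automorph_pow_mem hD h₀ h)
  have hε := one_lt_norm_eps_seq h₀ (pellIndex t₀ u₀)
  have hP := isPell_seq h (pellIndex t₀ u₀)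
  obtain ⟨c, hc, hcont, hgc⟩ := H3.exists_axis
    (g := embSL d (automorph Q h ^ (pellIndex t₀ u₀ + 1))) hε
    (by rw [embSL_trace, automorph_pow_succ, automorph_trace, emb_t_eq hP])
    (by
      rw [embSL_apply, automorph_pow_succ, automorph_10, map_ne_zero_iff _ emb_inj]
      exact mul_ne_zero (a_ne_zero hD) (u_ne_zero hP hε))
  exact exists_isClosedGeodesicOf hmem (pellLength_pos h₀) hc hcont hgc

theorem systole_eq {Q : BinForm (Od d)} {t₀ u₀ : Od d} (hD : IsDiscriminant Q.disc)
    (h₀ : IsFundamentalSolution Q.disc t₀ u₀) (h : IsPell Q.disc t₀ u₀)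
    (hlarge : 51 < ‖emb d Q.disc‖) :
    systole ((gammaD hD h₀).map (embSL d)) = pellLength Q.disc t₀ u₀ := by
  obtain ⟨f, hf⟩ := exists_closedGeodesic_pellLength hD h₀ h
  -- The form `Q` provides a geodesic attaining the bound, so the infimum is a genuine minimum.
  refine IsLeast.csInf_eq ⟨⟨f, hf.isClosedGeodesic⟩, ?_⟩
  rintro L ⟨f', hf'⟩
  exact pellLength_le hD h₀ hlarge hf'

theorem exists_closedGeodesic_systole (hlarge : 51 < ‖emb d Q.disc‖) :
    ∃ f, IsClosedGeodesicOf ((gammaD hD h₀).map (embSL d))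
      (embSL d (automorph Q h ^ (pellIndex t₀ u₀ + 1)))
      (systole ((gammaD hD h₀).map (embSL d))) f := by
  rw [systole_eq hD h₀ h hlarge]
  exact exists_closedGeodesic_pellLength hD h₀ h

end Form

/-- Each class of forms is sent to the free homotopy class of the geodesic of a chosen
representative. Only injectivity needs proof. -/
theorem formClassNumber_le_kiss {D t₀ u₀ : Od d} (hD : IsDiscriminant D)
    (hlarge : 51 < ‖emb d D‖) (h₀ : IsFundamentalSolution D t₀ u₀) :
    BinForm.formClassNumber D ≤ kiss ((gammaD hD h₀).map (embSL d)) := by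
  have hex : ∀ (Q : BinForm (Od d)) (hQ : Q.disc = D), ∃ f,
      IsClosedGeodesicOf ((gammaD hD h₀).map (embSL d))
        (embSL d (automorph Q (hQ.symm ▸ h₀.1 : IsPell Q.disc t₀ u₀) ^ (pellIndex t₀ u₀ + 1)))
        (systole ((gammaD hD h₀).map (embSL d))) f := by
    rintro Q rfl
    exact exists_closedGeodesic_systole hD h₀ h₀.1 hlarge
  choose f hf using hex
  let φ : Quotient (BinForm.formSetoid D) →
      {C : FreeHomotopyClass (Quot3 ((gammaD hD h₀).map (embSL d))) |
        ∃ f : Loop _, IsClosedGeodesic _ (systole ((gammaD hD h₀).map (embSL d))) f ∧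
          freeClass f = C} :=
    fun q => ⟨freeClass (f q.out.1 q.out.2.2), _, (hf q.out.1 q.out.2.2).isClosedGeodesic, rfl⟩
  refine ENat.card_le_card_of_injective (f := φ) fun q q' e => ?_
  have e' : freeClass (f q.out.1 q.out.2.2) = freeClass (f q'.out.1 q'.out.2.2) :=
    congrArg Subtype.val e
  rw [← q.out_eq, ← q'.out_eq]
  refine Quotient.sound ?_
  change q.out.1.Equivalent q'.out.1
  generalize q.out = Q at *
  generalize q'.out = Q' at *
  obtain ⟨Q, hQ, rfl⟩ := Q
  obtain ⟨Q', hQ', hQ'd⟩ := Q'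
  have h' : IsPell Q'.disc t₀ u₀ := hQ'd ▸ h₀.1
  have hmem : automorph Q' h' ^ (pellIndex t₀ u₀ + 1) ∈ gammaD hD h₀ := by
    -- `Γ` is built from the discriminant of `Q`, so the discriminant is generalized before being
    -- identified with that of `Q'`.
    have : ∀ (D : Od d) (hD : IsDiscriminant D) (h₀ : IsFundamentalSolution D t₀ u₀),
        Q'.disc = D → automorph Q' h' ^ (pellIndex t₀ u₀ + 1) ∈ gammaD hD h₀ := by
      rintro _ hD h₀ rfl
      exact automorph_pow_mem hD h₀ h'
    exact this _ hD h₀ hQ'd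
  have hfree : ∀ g ∈ (gammaD hD h₀).map (embSL d), ∀ p : H3, g • p = p → g = 1 :=
    fun _ hg p hp => gammaD_free hD h₀ hlarge hg p hp
  obtain ⟨_, ⟨δ, -, rfl⟩, hδ⟩ := exists_conj_of_freeClass_eq (isCoveringMap_proj hfree) hfree
    (Subgroup.mem_map_of_mem _ (automorph_pow_mem hD h₀ h₀.1)) (Subgroup.mem_map_of_mem _ hmem)
    (hf Q rfl) (hf Q' hQ'd) e'
  -- The conjugating element comes from `SL₂(𝒪_d)`, so the relation descends along `embSL`.
  rw [← map_mul, ← map_mul, embSL_injective.eq_iff, automorph_pow_succ, automorph_pow_succ] at hδ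
  exact equivalent_of_automorph_mul_eq
    (u_ne_zero (isPell_seq h₀.1 _) (one_lt_norm_eps_seq h₀ _)) _ _ hδ

end HypKiss

end

open HypKiss in
theorem proposition5p1 (d : ℕ) (hd0 : 0 < d) (hd : Squarefree d)
    (hcl : NumberField.classNumber (kd d) = 1)
    (D : Od d) (hD : IsDiscriminant D) (hlarge : 51 < ‖emb d D‖)
    (t₀ u₀ : Od d) (h₀ : IsFundamentalSolution D t₀ u₀) :
    -- the minimum defining `m = m(ε)` exists
    ‖emb d (pellT t₀ (pellIndex t₀ u₀))‖
        < 4 / 9 * ‖emb d (pellU t₀ u₀ (pellIndex t₀ u₀))‖ ^ 2 ∧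
    -- `M = Γ \ ℍ³` is a hyperbolic manifold
    IsDiscreteTorsionFree ((gammaD hD h₀).map (embSL d)) ∧
    BinForm.formClassNumber D ≤ kiss ((gammaD hD h₀).map (embSL d)) ∧
    (∀ (Q : BinForm (Od d)), Q.IsPrimitive → ∀ (hQ : Q.disc = D) (h : IsPell Q.disc t₀ u₀),
      Q.subst (automorph Q h) = Q ∧ IsPrimitiveLoxodromic (automorph Q h) ∧
      automorph Q h ^ (pellIndex t₀ u₀ + 1) ∈ gammaD hD h₀ ∧
      ∃ f, IsClosedGeodesicOf ((gammaD hD h₀).map (embSL d))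
        (embSL d (automorph Q h ^ (pellIndex t₀ u₀ + 1)))
        (systole ((gammaD hD h₀).map (embSL d))) f) ∧
    (∀ (Q Q' : BinForm (Od d)), Q.IsPrimitive → Q'.IsPrimitive → Q.disc = D → Q'.disc = D →
      ∀ (h : IsPell Q.disc t₀ u₀) (h' : IsPell Q'.disc t₀ u₀), ¬ Q.Equivalent Q' →
        ¬ IsConj (automorph Q h) (automorph Q' h') ∧
        ¬ IsConj (automorph Q h ^ (pellIndex t₀ u₀ + 1))
          (automorph Q' h' ^ (pellIndex t₀ u₀ + 1))) := by
  refine ⟨pellIndex_spec hD.ne_zero h₀, gammaD_isDiscreteTorsionFree hD h₀ hlarge,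
    formClassNumber_le_kiss hD hlarge h₀, ?_, ?_⟩
  · rintro Q hQ rfl h
    exact ⟨subst_automorph Q h, isPrimitiveLoxodromic_automorph hQ h₀ h,
      automorph_pow_mem hD h₀ h, exists_closedGeodesic_systole hD h₀ h hlarge⟩
  · rintro Q Q' - - rfl - h h' hne
    refine ⟨fun hc => hne (equivalent_of_isConj_automorph (u_ne_zero h₀.1 h₀.2.1) h h' hc),
      fun hc => hne ?_⟩
    rw [automorph_pow_succ, automorph_pow_succ] at hc
    exact equivalent_of_isConj_automorph
      (u_ne_zero (isPell_seq h₀.1 _) (one_lt_norm_eps_seq h₀ _)) _ _ hc
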